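/- **Setting.** Let $N\ge 1$ and let $\Theta\subset\mathbb R^{n_\theta}$, $\mathcal Z\subset\mathbb R^{n_z}$ be compact, $\mathcal Z\neq\emptyset$, $\mathcal X=\Theta\times\mathcal Z$. Let $h_0=f$ (objective) and $h_i=g_i$, $i=1,\dots,N$ (constraints) be functions on $\mathbb R^{n_\theta}\times\mathbb R^{n_z}$ such that $h_i$ lies in the reproducing kernel Hilbert space of a measurable kernel $k_i$ with norm at most $C_i$, and $k_i(x,x)\le 1$ on $\mathcal X$. Assume the uniform Slater condition with constant $\xi>0$: for every $z\in\mathcal Z$ there is $\bar\theta\in\Theta$ with $g_i(\bar\theta,z)\le-\xi$ for all $i$. For $z\in\mathcal Z$ let $\theta^*(z)$ be an optimal solution of $\min_{\theta\in\Theta}f(\theta,z)$ subject to $g_i(\theta,z)\le 0$ for all $i$. At step $t$ the query $x_t=(\theta_t,z_t)$ returns $y_{i,t}=h_i(x_t)+\nu_{i,t}$, where the noises are i.i.d. and $\sigma$-sub-Gaussian, and the noise of step $t$ is independent of $x_1,\dots,x_t$ and of the earlier noises. **Gaussian process surrogate.** For a noise variance $\lambda>0$ let $\mu_{i,t},\sigma_{i,t}$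 be the posterior mean and standard deviation after $t$ samples for the prior $\mathcal{GP}(0,k_i)$, and let $\gamma_{i,t}=\sup\frac12\log\det(I+\lambda^{-1}K_{i,A})$ over all $t$-tuples $A$ of points of $\mathcal X$ (repetitions allowed), where $K_{i,A}$ is the Gram matrix of $k_i$ on $A$. For $\delta\in(0,1)$ put $\beta_{i,t}^{1/2}=C_i+\sigma\sqrt{2(\gamma_{i,t-1}+1+\ln((N+1)/\delta))}$, and for $i=0,\dots,N$ $$\underline h_{i,t}=\max\{\mu_{i,t-1}-\beta_{i,t}^{1/2}\sigma_{i,t-1},-C_i\},\qquad \bar h_{i,t}=\min\{\mu_{i,t-1}+\beta_{i,t}^{1/2}\sigma_{i,t-1},C_i\}.$$ **Algorithm PDCBO with horizon $T$.** For $t=1,\dots,T$: observe $z_t\in\mathcal Z$, choose $\theta_t\in\arg\min_{\theta\in\Theta}\{\underline h_{0,t}(\theta,z_t)+\eta\sum_{i=1}^N\lambda_{t,i}\,\underline h_{i,t}(\theta,z_t)\}$, set $\lambda_{t+1,i}=\max\{\lambda_{t,i}+\underline h_{i,t}(\theta_t,z_t)+\epsilon,0\}$ for $i=1,\dots,N$,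 and observe $y_{i,t}$, $i=0,\dots,N$. Here $\eta=1/\sqrt T$; with $\|C\|^2=\sum_{i=1}^NC_i^2$ and $\ell=\frac{4C_0}{\eta\xi}+\frac{4\|C\|^2}{\xi}$, the initial dual variable is $\lambda_{1,i}=\ell$ for all $i$; and $$\epsilon=\epsilon_T=\frac1T\Big(\sqrt{N\ell^2+\tfrac{4C_0}{\eta}+4\|C\|^2}+8\,\|\beta^g_T\|\sqrt{T\|\gamma^g_T\|}\Big),$$ where $\beta_T^g=(\beta_{1,T}^{1/2},\dots,\beta_{N,T}^{1/2})$, $\gamma_T^g=(\gamma_{1,T},\dots,\gamma_{N,T})$ and all norms are Euclidean. **Theorem.** Let the noise variance $\lambda=\lambda(T)$ used with horizon $T$ satisfy $0<\lambda(T)\le 1+2/T$, and assume $\|\gamma^g_T\|/\sqrt T\to0$ as $T\to\infty$. Then there is a constant $c$, depending only on $N$, $C_0,\dots,C_N$, $\sigma$, $\delta$ and $\xi$, such that $\epsilon_T\le c\,\|\gamma_T^g\|/\sqrt T$ for all $T\ge1$; in particular $\epsilon_T\le\xi/2$ for all large $T$. Moreover, for every $T\ge 1$ with $\epsilon_T\le\xi/2$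 and every run of PDCBO with horizon $T$, let $E$ be the event that $\underline h_{i,t}(x)\le h_i(x)\le\bar h_{i,t}(x)$ for all $x\in\mathcal X$, $1\le t\le T$ and $0\le i\le N$. If $\lambda(T)\ge1$, then $E$ has probability at least $1-\delta$; and on $E$ $$\mathcal R_T=\sum_{t=1}^T\big(f(\theta_t,z_t)-f(\theta^*(z_t),z_t)\big)\le c\sum_{i=0}^N\gamma_{i,T}\sqrt T,\qquad \mathcal V_T=\Big\|\Big[\sum_{t=1}^Tg(\theta_t,z_t)\Big]^+\Big\|=0,$$ where $[\cdot]^+$ is the componentwise positive part. -/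

import Mathlib

open MeasureTheory ProbabilityTheory Filter Topology
open scoped NNReal

noncomputable section

namespace PDCBO

/-- Euclidean norm of a finite real vector. -/
def euclNorm {n : ℕ} (v : Fin n → ℝ) : ℝ := √(∑ i, v i ^ 2)

/-! ### Gaussian process regression -/

section GP

variable {X : Type*}

/-- Gram matrix of `k` at the points `x`. -/
def gram (k : X → X → ℝ) {n : ℕ} (x : Fin n → X) : Matrix (Fin n) (Fin n) ℝ :=
  Matrix.of fun i j => k (x i) (x j)

/-- Posterior mean at `p` after the data `(x, y)`, with noise variance `lam`. -/
def postMean (k : X → X → ℝ) (lam : ℝ) {n : ℕ} (x : Fin n → X) (y : Fin n → ℝ) (p : X) : ℝ :=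
  (fun j => k (x j) p) ⬝ᵥ
    Matrix.mulVec (gram k x + lam • (1 : Matrix (Fin n) (Fin n) ℝ))⁻¹ y

/-- Posterior covariance at `p, q` after sampling at the points `x`. -/
def postCov (k : X → X → ℝ) (lam : ℝ) {n : ℕ} (x : Fin n → X) (p q : X) : ℝ :=
  k p q - (fun j => k (x j) p) ⬝ᵥ
    Matrix.mulVec (gram k x + lam • (1 : Matrix (Fin n) (Fin n) ℝ))⁻¹ (fun j => k (x j) q)

/-- Posterior standard deviation. -/
def postStd (k : X → X → ℝ) (lam : ℝ) {n : ℕ} (x : Fin n → X) (p : X) : ℝ :=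
  √(postCov k lam x p p)

/-- Maximum information gain of `t` samples from `D`: the supremum, over all `t`-tuples of points
of `D` (repetitions allowed), of `(1/2) log det (I + lam⁻¹ K)`. -/
def maxInfoGain (k : X → X → ℝ) (lam : ℝ) (D : Set X) (t : ℕ) : ℝ :=
  ⨆ A : Fin t → D,
    (1 / 2) * Real.log
      (1 + lam⁻¹ • gram k (fun j => (A j : X)) : Matrix (Fin t) (Fin t) ℝ).det

/-- `f` belongs to the reproducing kernel Hilbert space with kernel `k`, with norm at most `C`. -/
def InRKHSBall {X : Type} (k : X → X → ℝ) (C : ℝ) (f : X → ℝ) : Prop :=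
  ∃ (H : Type) (_ : NormedAddCommGroup H) (_ : InnerProductSpace ℝ H) (_ : CompleteSpace H)
    (_ : RKHS ℝ H X ℝ),
    (∀ x y : X, RKHS.kernel H x y 1 = k x y) ∧
    ∃ F : H, (∀ x, F x = f x) ∧ ‖F‖ ≤ C

end GP

/-! ### The contextual problem -/

/-- Pairs (control parameter, context). -/
abbrev Pt (nθ nz : ℕ) : Type := EuclideanSpace ℝ (Fin nθ) × EuclideanSpace ℝ (Fin nz)

/-- The data of the problem: candidate set, context set, kernels (index `0` is the objective,
index `i.succ` the `i`-th constraint), objective and constraints. -/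
structure Setting (nθ nz N : ℕ) where
  Θ : Set (EuclideanSpace ℝ (Fin nθ))
  Z : Set (EuclideanSpace ℝ (Fin nz))
  k : Fin (N + 1) → Pt nθ nz → Pt nθ nz → ℝ
  f : Pt nθ nz → ℝ
  g : Fin N → Pt nθ nz → ℝ

/-- Scalar parameters: norm bounds `C 0, …, C N`, the sub-Gaussian parameter `σ` of the noise, the
confidence parameter `δ` and the Slater constant `ξ`. -/
structure Params (N : ℕ) where
  C : Fin (N + 1) → ℝ
  σ : ℝ≥0
  δ : ℝ
  ξ : ℝ

variable {nθ nz N : ℕ}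

/-- The black-box functions as one family: `f` at index `0`, then the constraints. -/
def Setting.fn (S : Setting nθ nz N) : Fin (N + 1) → Pt nθ nz → ℝ := Fin.cons S.f S.g

/-- The set on which the functions are learned. -/
def Setting.dom (S : Setting nθ nz N) : Set (Pt nθ nz) := S.Θ ×ˢ S.Z

/-- The standing assumptions on the problem. -/
structure Setting.Regular (S : Setting nθ nz N) (P : Params N) : Prop where
  compact_Θ : IsCompact S.Θ
  compact_Z : IsCompact S.Z
  nonempty_Z : S.Z.Nonempty
  rkhs : ∀ i, InRKHSBall (S.k i) (P.C i) (S.fn i)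
  normalized : ∀ i, ∀ x ∈ S.dom, S.k i x x ≤ 1
  measurable_k : ∀ i, Measurable fun p : Pt nθ nz × Pt nθ nz => S.k i p.1 p.2
  slater : ∀ z ∈ S.Z, ∃ θ ∈ S.Θ, ∀ i, S.g i (θ, z) ≤ -P.ξ

/-- `θ` is an optimal solution of the constrained problem with context `z`. -/
def Setting.IsOptimal (S : Setting nθ nz N) (z : EuclideanSpace ℝ (Fin nz))
    (θ : EuclideanSpace ℝ (Fin nθ)) : Prop :=
  θ ∈ S.Θ ∧ (∀ i, S.g i (θ, z) ≤ 0) ∧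
    ∀ θ' ∈ S.Θ, (∀ i, S.g i (θ', z) ≤ 0) → S.f (θ, z) ≤ S.f (θ', z)

/-! ### Confidence bounds -/

/-- Maximum information gain `γ_{i,t}`. -/
def Setting.γ (S : Setting nθ nz N) (lam : ℝ) (i : Fin (N + 1)) (t : ℕ) : ℝ :=
  maxInfoGain (S.k i) lam S.dom t

/-- The vector `γ^g_t` of the maximum information gains of the constraints. -/
def Setting.γg (S : Setting nθ nz N) (lam : ℝ) (t : ℕ) : Fin N → ℝ := fun i => S.γ lam i.succ t

/-- The confidence width multiplier `β_{i,t}^{1/2}`, for `t ≥ 1`. -/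
def sqrtBeta (S : Setting nθ nz N) (P : Params N) (lam : ℝ) (i : Fin (N + 1)) (t : ℕ) : ℝ :=
  P.C i + P.σ * √(2 * (S.γ lam i (t - 1) + 1 + Real.log (((N : ℝ) + 1) / P.δ)))

/-- Lower confidence bound of the `i`-th function at step `t ≥ 1`, computed from the samples
`x 1, …, x (t - 1)` and observations `y i 1, …, y i (t - 1)`. -/
def lcb (S : Setting nθ nz N) (P : Params N) (lam : ℝ) (x : ℕ → Pt nθ nz)
    (y : Fin (N + 1) → ℕ → ℝ) (i : Fin (N + 1)) (t : ℕ) (p : Pt nθ nz) : ℝ :=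
  max (postMean (S.k i) lam (fun j : Fin (t - 1) => x (j + 1)) (fun j => y i (j + 1)) p
      - sqrtBeta S P lam i t * postStd (S.k i) lam (fun j : Fin (t - 1) => x (j + 1)) p)
    (-P.C i)

/-- Upper confidence bound of the `i`-th function at step `t ≥ 1`. -/
def ucb (S : Setting nθ nz N) (P : Params N) (lam : ℝ) (x : ℕ → Pt nθ nz)
    (y : Fin (N + 1) → ℕ → ℝ) (i : Fin (N + 1)) (t : ℕ) (p : Pt nθ nz) : ℝ :=
  min (postMean (S.k i) lam (fun j : Fin (t - 1) => x (j + 1)) (fun j => y i (j + 1)) p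
      + sqrtBeta S P lam i t * postStd (S.k i) lam (fun j : Fin (t - 1) => x (j + 1)) p)
    (P.C i)

/-! ### Algorithm parameters for a horizon `T` -/

/-- The vector `C = (C_1, …, C_N)`. -/
def Params.Cg (P : Params N) : Fin N → ℝ := fun i => P.C i.succ

/-- The scaling factor `η`. -/
def eta (T : ℕ) : ℝ := 1 / √(T : ℝ)

/-- Common value of the coordinates of the initial dual variable. -/
def dualInit (P : Params N) (T : ℕ) : ℝ :=
  4 * P.C 0 / (eta T * P.ξ) + 4 * euclNorm P.Cg ^ 2 / P.ξ

/-- The slackness parameter `ε`. -/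
def eps (S : Setting nθ nz N) (P : Params N) (lam : ℝ) (T : ℕ) : ℝ :=
  (√(N * dualInit P T ^ 2 + 4 * P.C 0 / eta T + 4 * euclNorm P.Cg ^ 2)
    + 8 * euclNorm (fun i : Fin N => sqrtBeta S P lam i.succ T)
      * √(T * euclNorm (S.γg lam T))) / T

/-! ### Runs -/

/-- `θ, Λ` is produced by PDCBO with horizon `T` and Gaussian process noise variance `lam` from the
contexts `z` and the observations `y`, along one sample path. The dual variable is called `Λ`. -/
structure IsPath (S : Setting nθ nz N) (P : Params N) (lam : ℝ) (T : ℕ)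
    (θ : ℕ → EuclideanSpace ℝ (Fin nθ)) (z : ℕ → EuclideanSpace ℝ (Fin nz))
    (y : Fin (N + 1) → ℕ → ℝ) (Λ : ℕ → Fin N → ℝ) : Prop where
  context_mem : ∀ t ∈ Finset.Icc 1 T, z t ∈ S.Z
  dual_one : ∀ i, Λ 1 i = dualInit P T
  primal_mem : ∀ t ∈ Finset.Icc 1 T, θ t ∈ S.Θ
  primal_min : ∀ t ∈ Finset.Icc 1 T,
    IsMinOn (fun θ' => lcb S P lam (fun s => (θ s, z s)) y 0 t (θ', z t)
      + eta T * ∑ i, Λ t i * lcb S P lam (fun s => (θ s, z s)) y i.succ t (θ', z t)) S.Θ (θ t)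
  dual_update : ∀ t ∈ Finset.Icc 1 T, ∀ i,
    Λ (t + 1) i
      = max (Λ t i + lcb S P lam (fun s => (θ s, z s)) y i.succ t (θ t, z t) + eps S P lam T) 0

variable {Ω : Type*} [mΩ : MeasurableSpace Ω]

/-- The sampled points along the outcome `ω`. -/
def pts (θ : ℕ → Ω → EuclideanSpace ℝ (Fin nθ)) (z : ℕ → Ω → EuclideanSpace ℝ (Fin nz))
    (ω : Ω) : ℕ → Pt nθ nz := fun t => (θ t ω, z t ω)

/-- The noisy observations along the outcome `ω`. -/
def obs (S : Setting nθ nz N) (θ : ℕ → Ω → EuclideanSpace ℝ (Fin nθ))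
    (z : ℕ → Ω → EuclideanSpace ℝ (Fin nz)) (ν : Fin (N + 1) → ℕ → Ω → ℝ) (ω : Ω) :
    Fin (N + 1) → ℕ → ℝ := fun i t => S.fn i (pts θ z ω t) + ν i t ω

/-- A random run of PDCBO over `T` steps. The noises are i.i.d. and `σ`-sub-Gaussian. `ℱ t` is the
information available right before the evaluation of step `t`: it determines the points sampled up
to step `t` and the noises up to step `t - 1`, and the noise of step `t` is independent of it. -/
structure IsRun (S : Setting nθ nz N) (P : Params N) (lam : ℝ) (T : ℕ) (μ : Measure Ω)
    (ℱ : Filtration ℕ mΩ) (θ : ℕ → Ω → EuclideanSpace ℝ (Fin nθ))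
    (z : ℕ → Ω → EuclideanSpace ℝ (Fin nz)) (ν : Fin (N + 1) → ℕ → Ω → ℝ)
    (Λ : ℕ → Ω → Fin N → ℝ) : Prop where
  path : ∀ ω, IsPath S P lam T (fun t => θ t ω) (fun t => z t ω) (obs S θ z ν ω) (fun t => Λ t ω)
  noise_indep : iIndepFun (fun (p : Fin (N + 1) × Finset.Icc 1 T) => ν p.1 p.2) μ
  noise_ident : ∀ p q : Fin (N + 1) × Finset.Icc 1 T,
    IdentDistrib (ν p.1 p.2) (ν q.1 q.2) μ μ
  noise_subG : ∀ i, ∀ t ∈ Finset.Icc 1 T, HasSubgaussianMGF (ν i t) (P.σ ^ 2) μ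
  primal_meas : ∀ t ∈ Finset.Icc 1 T, Measurable[ℱ t] (θ t)
  context_meas : ∀ t ∈ Finset.Icc 1 T, Measurable[ℱ t] (z t)
  noise_meas : ∀ i, ∀ t ∈ Finset.Icc 1 T, Measurable[ℱ (t + 1)] (ν i t)
  noise_indep_past : ∀ t ∈ Finset.Icc 1 T,
    Indep (MeasurableSpace.comap (fun ω i => ν i t ω) inferInstance) (ℱ t) μ

/-- The confidence event: at all steps, all functions lie between their confidence bounds on the
whole domain. -/
def confEvent (S : Setting nθ nz N) (P : Params N) (lam : ℝ) (T : ℕ)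
    (θ : ℕ → Ω → EuclideanSpace ℝ (Fin nθ)) (z : ℕ → Ω → EuclideanSpace ℝ (Fin nz))
    (ν : Fin (N + 1) → ℕ → Ω → ℝ) : Set Ω :=
  {ω | ∀ t ∈ Finset.Icc 1 T, ∀ x ∈ S.dom, ∀ i,
    S.fn i x ∈ Set.Icc (lcb S P lam (pts θ z ω) (obs S θ z ν ω) i t x)
      (ucb S P lam (pts θ z ω) (obs S θ z ν ω) i t x)}

/-- Cumulative contextual regret against the optimal solutions `θstar`. -/
def regret (S : Setting nθ nz N) (θstar : EuclideanSpace ℝ (Fin nz) → EuclideanSpace ℝ (Fin nθ))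
    (T : ℕ) (x : ℕ → Pt nθ nz) : ℝ :=
  ∑ t ∈ Finset.Icc 1 T, (S.f (x t) - S.f (θstar (x t).2, (x t).2))

/-- Cumulative constraint violation. -/
def violation (S : Setting nθ nz N) (T : ℕ) (x : ℕ → Pt nθ nz) : ℝ :=
  euclNorm fun i : Fin N => max (∑ t ∈ Finset.Icc 1 T, S.g i (x t)) 0

end PDCBO

end

/-! The argument splits into one probabilistic statement, the confidence bounds, and a deterministic
drift analysis on the event where they hold.

Confidence. Write a function of the RKHS as `⟪F, φ p⟫` with `k = ⟪φ, φ⟫`. Its distance to the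
posterior mean is a bias of at most `‖F‖` posterior standard deviations, plus the posterior mean of
the noise `e`, which Cauchy-Schwarz bounds by the standard deviation times `√(q / lam)`, where `q`
is `selfNormSq`, the quadratic form of `K (K + lam)⁻¹` at `e`. Adding one sample changes `q` and the
information gain by explicit functions of the posterior at the new point (`selfNormSq_succ`,
`infoGain_succ`). Hence `exp (q / (2σ²) - infoGain)` is a product of one-step factors. Each has
conditional mean at most one, because the exponential of a quadratic is a Gaussian mixture of the
exponentials that sub-Gaussianity controls (`lintegral_exp_increment_le`). Ville's inequality then
bounds `q` for all sample sizes at once.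

Drift. On the confidence event the Slater point competes in the primal minimization, so the squared
norm of the dual variable has drift at most a constant minus `ξ` times the sum of the dual
coordinates. It therefore stays below `dualBound` (`sum_sq_dual_le`). Unrolling the dual update
bounds each cumulative lower confidence bound by the last dual coordinate minus `T ε`, and `ε` is
large enough to pay for both that coordinate and the confidence widths: no violation. Comparing the
primal step with the optimal point instead, and telescoping the squared dual norms, bounds the
regret. The widths sum to order `√(T γ)`, since the posterior variances sum to a multiple of the
information gain (`sum_postCov_le`).

Constants. Slater's condition forces each constraint to have a kernel value bounded below, hence an
information gain bounded below (`le_γ_succ`). All additive constants can then be absorbed into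
multiples of the information gain. -/

noncomputable section

namespace PDCBO

open Matrix
open scoped ENNReal InnerProductSpace

/-! ### Linear algebra of Gaussian process regression -/

section GPAlgebra

variable {X : Type*} {H : Type*} [NormedAddCommGroup H] [InnerProductSpace ℝ H]

/-- `k` is the kernel of the feature map `φ`. -/
def IsFeatureMap (k : X → X → ℝ) (φ : X → H) : Prop := ∀ x y, k x y = ⟪φ x, φ y⟫_ℝ

/-- Regularized Gram matrix. -/
def regGram (k : X → X → ℝ) (lam : ℝ) {n : ℕ} (x : Fin n → X) : Matrix (Fin n) (Fin n) ℝ :=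
  gram k x + lam • (1 : Matrix (Fin n) (Fin n) ℝ)

/-- The quadratic form of `K (K + lam)⁻¹ = 1 - lam (K + lam)⁻¹`. -/
def selfNormSq (k : X → X → ℝ) (lam : ℝ) {n : ℕ} (x : Fin n → X) (e : Fin n → ℝ) : ℝ :=
  e ⬝ᵥ e - lam * (e ⬝ᵥ (regGram k lam x)⁻¹ *ᵥ e)

/-- Information gain of the sample points `x`. -/
def infoGain (k : X → X → ℝ) (lam : ℝ) {n : ℕ} (x : Fin n → X) : ℝ :=
  (1 / 2) * Real.log (1 + lam⁻¹ • gram k x : Matrix (Fin n) (Fin n) ℝ).det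

theorem dotProduct_self_nonneg {n : ℕ} (v : Fin n → ℝ) : 0 ≤ v ⬝ᵥ v :=
  Finset.sum_nonneg fun i _ => mul_self_nonneg (v i)

theorem postMean_eq (k : X → X → ℝ) (lam : ℝ) {n : ℕ} (x : Fin n → X) (y : Fin n → ℝ) (p : X) :
    postMean k lam x y p = (fun j => k (x j) p) ⬝ᵥ (regGram k lam x)⁻¹ *ᵥ y := rfl

theorem postCov_eq (k : X → X → ℝ) (lam : ℝ) {n : ℕ} (x : Fin n → X) (p q : X) :
    postCov k lam x p q
      = k p q - (fun j => k (x j) p) ⬝ᵥ (regGram k lam x)⁻¹ *ᵥ (fun j => k (x j) q) := rfl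

theorem regGram_mulVec (k : X → X → ℝ) (lam : ℝ) {n : ℕ} (x : Fin n → X) (u : Fin n → ℝ) :
    regGram k lam x *ᵥ u = gram k x *ᵥ u + lam • u := by
  simp [regGram, add_mulVec, smul_mulVec]

theorem det_one_add_smul_gram (k : X → X → ℝ) {lam : ℝ} (hl : 0 < lam) {n : ℕ} (x : Fin n → X) :
    (1 + lam⁻¹ • gram k x : Matrix (Fin n) (Fin n) ℝ).det
      = lam⁻¹ ^ n * (regGram k lam x).det := by
  have : (1 + lam⁻¹ • gram k x : Matrix (Fin n) (Fin n) ℝ) = lam⁻¹ • regGram k lam x := by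
    rw [regGram, smul_add, smul_smul, inv_mul_cancel₀ hl.ne', one_smul, add_comm]
  rw [this, det_smul, Fintype.card_fin]

namespace IsFeatureMap

variable {k : X → X → ℝ} {φ : X → H} (hk : IsFeatureMap k φ) {lam : ℝ}
include hk

theorem symm (x y : X) : k x y = k y x := by rw [hk, hk, real_inner_comm]

theorem diag_nonneg (x : X) : 0 ≤ k x x := by rw [hk]; exact real_inner_self_nonneg

theorem gram_isHermitian {n : ℕ} (x : Fin n → X) : (gram k x)ᵀ = gram k x := by
  ext i j; simp [gram, hk.symm (x j)]

theorem gram_mulVec_apply {n : ℕ} (x : Fin n → X) (u : Fin n → ℝ) (i : Fin n) :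
    (gram k x *ᵥ u) i = ⟪φ (x i), ∑ j, u j • φ (x j)⟫_ℝ := by
  simp [mulVec, dotProduct, gram, inner_sum, inner_smul_right, hk _ _, mul_comm]

theorem dotProduct_gram_mulVec {n : ℕ} (x : Fin n → X) (u w : Fin n → ℝ) :
    u ⬝ᵥ gram k x *ᵥ w = ⟪∑ j, u j • φ (x j), ∑ j, w j • φ (x j)⟫_ℝ := by
  rw [sum_inner]
  simp only [dotProduct, hk.gram_mulVec_apply, inner_smul_left, RCLike.conj_to_real]

theorem posDef_regGram (hl : 0 < lam) {n : ℕ} (x : Fin n → X) : (regGram k lam x).PosDef := by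
  have h1 : (gram k x).PosSemidef := by
    refine PosSemidef.of_dotProduct_mulVec_nonneg ?_ fun u => ?_
    · simpa [IsHermitian] using hk.gram_isHermitian x
    · rw [star_trivial, hk.dotProduct_gram_mulVec]; exact real_inner_self_nonneg
  exact PosDef.posSemidef_add h1 (PosDef.one.smul hl)

theorem isUnit_det_regGram (hl : 0 < lam) {n : ℕ} (x : Fin n → X) :
    IsUnit (regGram k lam x).det := (hk.posDef_regGram hl x).det_pos.ne'.isUnit

theorem regGram_mulVec_inv (hl : 0 < lam) {n : ℕ} (x : Fin n → X) (b : Fin n → ℝ) :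
    regGram k lam x *ᵥ ((regGram k lam x)⁻¹ *ᵥ b) = b := by
  rw [mulVec_mulVec, mul_nonsing_inv _ (hk.isUnit_det_regGram hl x), one_mulVec]

theorem inv_mulVec_eq (hl : 0 < lam) {n : ℕ} (x : Fin n → X) {b u : Fin n → ℝ}
    (h : regGram k lam x *ᵥ u = b) : (regGram k lam x)⁻¹ *ᵥ b = u := by
  rw [← h, mulVec_mulVec, nonsing_inv_mul _ (hk.isUnit_det_regGram hl x), one_mulVec]

theorem dotProduct_regGram_comm {n : ℕ} (x : Fin n → X) (u w : Fin n → ℝ) :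
    u ⬝ᵥ regGram k lam x *ᵥ w = w ⬝ᵥ regGram k lam x *ᵥ u := by
  simp only [regGram_mulVec, dotProduct_add, hk.dotProduct_gram_mulVec, dotProduct_smul,
    dotProduct_comm u w, real_inner_comm]

theorem dotProduct_inv_comm (hl : 0 < lam) {n : ℕ} (x : Fin n → X) (a b : Fin n → ℝ) :
    a ⬝ᵥ (regGram k lam x)⁻¹ *ᵥ b = b ⬝ᵥ (regGram k lam x)⁻¹ *ᵥ a := by
  conv_lhs => rw [← hk.regGram_mulVec_inv hl x a]
  conv_rhs => rw [← hk.regGram_mulVec_inv hl x b]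
  rw [dotProduct_comm, hk.dotProduct_regGram_comm, dotProduct_comm,
    dotProduct_comm _ ((regGram k lam x)⁻¹ *ᵥ a), hk.dotProduct_regGram_comm x]

/-- The posterior variance as the value of a regularized least squares problem. -/
theorem postCov_self_eq (hl : 0 < lam) {n : ℕ} (x : Fin n → X) (p : X) :
    postCov k lam x p p
      = ‖φ p - ∑ j, ((regGram k lam x)⁻¹ *ᵥ fun j => k (x j) p) j • φ (x j)‖ ^ 2
        + lam * ((regGram k lam x)⁻¹ *ᵥ (fun j => k (x j) p)
          ⬝ᵥ (regGram k lam x)⁻¹ *ᵥ fun j => k (x j) p) := by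
  set b : Fin n → ℝ := fun j => k (x j) p with hb
  set v := (regGram k lam x)⁻¹ *ᵥ b with hv
  have hAv : gram k x *ᵥ v + lam • v = b := by
    rw [← regGram_mulVec]; exact hk.regGram_mulVec_inv hl x b
  have h1 : v ⬝ᵥ b = ‖∑ j, v j • φ (x j)‖ ^ 2 + lam * (v ⬝ᵥ v) := by
    conv_lhs => rw [← hAv]
    rw [dotProduct_add, hk.dotProduct_gram_mulVec, real_inner_self_eq_norm_sq, dotProduct_smul,
      smul_eq_mul]
  have h2 : ⟪φ p, ∑ j, v j • φ (x j)⟫_ℝ = v ⬝ᵥ b := by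
    simp [inner_sum, inner_smul_right, dotProduct, hb, hk _ _, real_inner_comm]
  rw [postCov_eq, ← hb, ← hv, dotProduct_comm b v, @norm_sub_sq_real, h2, hk p p,
    real_inner_self_eq_norm_sq]
  linarith

theorem postCov_self_nonneg (hl : 0 < lam) {n : ℕ} (x : Fin n → X) (p : X) :
    0 ≤ postCov k lam x p p := by
  rw [hk.postCov_self_eq hl]
  have := dotProduct_self_nonneg ((regGram k lam x)⁻¹ *ᵥ fun j => k (x j) p)
  positivity

theorem postCov_self_le (hl : 0 < lam) {n : ℕ} (x : Fin n → X) (p : X) :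
    postCov k lam x p p ≤ k p p := by
  rw [postCov_eq]
  have := (hk.posDef_regGram hl x).inv.posSemidef.dotProduct_mulVec_nonneg (fun j => k (x j) p)
  rw [star_trivial] at this
  linarith

theorem postStd_sq (hl : 0 < lam) {n : ℕ} (x : Fin n → X) (p : X) :
    postStd k lam x p ^ 2 = postCov k lam x p p := Real.sq_sqrt (hk.postCov_self_nonneg hl x p)

/-- Substitute `e = K u + lam u`. The resulting sum of squares is dual, up to the weight `lam`, to
the one in `postCov_self_eq`, which is what Cauchy-Schwarz needs. -/
theorem selfNormSq_eq (hl : 0 < lam) {n : ℕ} (x : Fin n → X) (e : Fin n → ℝ) :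
    selfNormSq k lam x e
      = lam * ‖∑ j, ((regGram k lam x)⁻¹ *ᵥ e) j • φ (x j)‖ ^ 2
        + gram k x *ᵥ ((regGram k lam x)⁻¹ *ᵥ e) ⬝ᵥ gram k x *ᵥ ((regGram k lam x)⁻¹ *ᵥ e) := by
  set u := (regGram k lam x)⁻¹ *ᵥ e with hu
  have hAu : gram k x *ᵥ u + lam • u = e := by
    rw [← regGram_mulVec]; exact hk.regGram_mulVec_inv hl x e
  have h1 : u ⬝ᵥ gram k x *ᵥ u = ‖∑ j, u j • φ (x j)‖ ^ 2 := by
    rw [hk.dotProduct_gram_mulVec, real_inner_self_eq_norm_sq]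
  rw [selfNormSq, ← hu, ← h1]
  conv_lhs => rw [← hAu]
  simp only [dotProduct_add, add_dotProduct, dotProduct_smul, smul_dotProduct, smul_eq_mul,
    dotProduct_comm (gram k x *ᵥ u) u]
  ring

/-- Cauchy-Schwarz inequality for the contribution of the noise to the posterior mean. -/
theorem abs_postMean_le (hl : 0 < lam) {n : ℕ} (x : Fin n → X) (e : Fin n → ℝ) (p : X) :
    |postMean k lam x e p| ≤ postStd k lam x p * √(selfNormSq k lam x e / lam) := by
  set b : Fin n → ℝ := fun j => k (x j) p with hb
  set v := (regGram k lam x)⁻¹ *ᵥ b with hv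
  set u := (regGram k lam x)⁻¹ *ᵥ e with hu
  set r := φ p - ∑ j, v j • φ (x j) with hr
  set w := ∑ j, u j • φ (x j) with hw
  set g := gram k x *ᵥ u with hg
  -- The mean pairs `(r, v)` with `(w, g)`. The squared norms of these pairs, with weights `lam` and
  -- `lam⁻¹` on the second entries, are the posterior variance and `selfNormSq / lam`.
  have h1 : postMean k lam x e p = ⟪r, w⟫_ℝ + v ⬝ᵥ g := by
    rw [postMean_eq, ← hu, hg, hk.dotProduct_gram_mulVec, ← hw, hr, inner_sub_left]
    simp [hw, inner_sum, inner_smul_right, dotProduct, hk _ _, real_inner_comm, mul_comm]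
  have hs : postCov k lam x p p = ‖r‖ ^ 2 + lam * (v ⬝ᵥ v) := hk.postCov_self_eq hl x p
  have hq : selfNormSq k lam x e / lam = ‖w‖ ^ 2 + lam⁻¹ * (g ⬝ᵥ g) := by
    rw [hk.selfNormSq_eq hl]; field_simp; rfl
  have hvv := dotProduct_self_nonneg v
  have hgg := dotProduct_self_nonneg g
  have h2 : (v ⬝ᵥ g) ^ 2 ≤ (v ⬝ᵥ v) * (g ⬝ᵥ g) := by
    have := Finset.sum_mul_sq_le_sq_mul_sq Finset.univ v g
    simpa [dotProduct, sq] using this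
  have h3 : |⟪r, w⟫_ℝ| ≤ ‖r‖ * ‖w‖ := abs_real_inner_le_norm r w
  rw [postStd, ← Real.sqrt_mul (hk.postCov_self_nonneg hl x p), h1, hs, hq]
  refine (abs_add_le _ _).trans (Real.le_sqrt_of_sq_le ?_)
  have h4 : |v ⬝ᵥ g| ≤ √(v ⬝ᵥ v) * √(g ⬝ᵥ g) := by
    rw [← Real.sqrt_mul hvv]; exact Real.abs_le_sqrt h2
  set a := √(v ⬝ᵥ v) with ha
  set c := √(g ⬝ᵥ g) with hc
  rw [← Real.sq_sqrt hvv, ← Real.sq_sqrt hgg, ← ha, ← hc]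
  have h5 : (|⟪r, w⟫_ℝ| + |v ⬝ᵥ g|) ^ 2 ≤ (‖r‖ * ‖w‖ + a * c) ^ 2 := by gcongr
  refine h5.trans ?_
  -- The square root of `lam` balances the weights, so that Lagrange's identity exhibits the
  -- Cauchy-Schwarz defect as a single square.
  obtain ⟨s, hs0, hs2⟩ : ∃ s : ℝ, 0 < s ∧ lam = s ^ 2 :=
    ⟨√lam, Real.sqrt_pos.2 hl, (Real.sq_sqrt hl.le).symm⟩
  have : (‖r‖ ^ 2 + lam * a ^ 2) * (‖w‖ ^ 2 + lam⁻¹ * c ^ 2) - (‖r‖ * ‖w‖ + a * c) ^ 2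
      = (s * a * ‖w‖ - s⁻¹ * ‖r‖ * c) ^ 2 := by
    rw [hs2]; field_simp; ring
  nlinarith [sq_nonneg (s * a * ‖w‖ - s⁻¹ * ‖r‖ * c)]

/-- The bias of the posterior mean. -/
theorem abs_sub_postMean_le (hl : 0 < lam) {n : ℕ} (x : Fin n → X) (F : H) (p : X) :
    |⟪F, φ p⟫_ℝ - postMean k lam x (fun j => ⟪F, φ (x j)⟫_ℝ) p| ≤ ‖F‖ * postStd k lam x p := by
  set b : Fin n → ℝ := fun j => k (x j) p with hb
  set v := (regGram k lam x)⁻¹ *ᵥ b with hv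
  set r := φ p - ∑ j, v j • φ (x j) with hr
  -- The bias is `F` paired with the residual of `φ p` in the regularized least squares problem,
  -- whose norm is at most the posterior standard deviation.
  have h1 : ⟪F, φ p⟫_ℝ - postMean k lam x (fun j => ⟪F, φ (x j)⟫_ℝ) p = ⟪F, r⟫_ℝ := by
    rw [postMean_eq, hk.dotProduct_inv_comm hl, hr, inner_sub_right, inner_sum, ← hb, ← hv]
    simp [dotProduct, inner_smul_right, mul_comm]
  have h2 : ‖r‖ ≤ postStd k lam x p := by
    refine Real.le_sqrt_of_sq_le ?_
    rw [hk.postCov_self_eq hl]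
    have := dotProduct_self_nonneg v
    simp only [← hb, ← hv, ← hr]
    nlinarith
  rw [h1]
  exact (abs_real_inner_le_norm F r).trans (by gcongr)

/-- Solution of the regularized system after adding one sample point. -/
theorem regGram_succ_mulVec (hl : 0 < lam) {n : ℕ} (x : Fin (n + 1) → X) (y : Fin (n + 1) → ℝ) :
    regGram k lam x *ᵥ Fin.snoc (α := fun _ => ℝ)
      ((regGram k lam fun j : Fin n => x j.castSucc)⁻¹ *ᵥ (fun j => y j.castSucc)
        - ((y (Fin.last n) - postMean k lam (fun j : Fin n => x j.castSucc)
            (fun j => y j.castSucc) (x (Fin.last n)))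
          / (lam + postCov k lam (fun j : Fin n => x j.castSucc) (x (Fin.last n)) (x (Fin.last n))))
        • (regGram k lam fun j : Fin n => x j.castSucc)⁻¹ *ᵥ
            fun j => k (x j.castSucc) (x (Fin.last n)))
      ((y (Fin.last n) - postMean k lam (fun j : Fin n => x j.castSucc)
            (fun j => y j.castSucc) (x (Fin.last n)))
          / (lam + postCov k lam (fun j : Fin n => x j.castSucc) (x (Fin.last n)) (x (Fin.last n))))
      = y := by
  set x' : Fin n → X := fun j => x j.castSucc with hx'
  set y' : Fin n → ℝ := fun j => y j.castSucc
  set q := x (Fin.last n) with hq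
  set b : Fin n → ℝ := fun j => k (x' j) q with hb
  set s := postCov k lam x' q q with hs
  set m := postMean k lam x' y' q with hm
  -- Block elimination: `lam + s` is the Schur complement of the old block, so the new coordinate is
  -- the prediction error divided by it.
  set c := (y (Fin.last n) - m) / (lam + s) with hc
  have hpos : 0 < lam + s := by linarith [hk.postCov_self_nonneg hl x' q]
  set α := (regGram k lam x')⁻¹ *ᵥ y' with hα
  set w := (regGram k lam x')⁻¹ *ᵥ b with hw
  have h1 : gram k x' *ᵥ α + lam • α = y' := by
    rw [← regGram_mulVec]; exact hk.regGram_mulVec_inv hl x' y'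
  have h2 : gram k x' *ᵥ w + lam • w = b := by
    rw [← regGram_mulVec]; exact hk.regGram_mulVec_inv hl x' b
  have h3 : gram k x' *ᵥ (α - c • w) + lam • (α - c • w) = y' - c • b := by
    rw [← h1, ← h2, mulVec_sub, mulVec_smul]; module
  ext i
  rw [regGram_mulVec]
  refine Fin.lastCases ?_ (fun i => ?_) i
  · have h4 : s = k q q - b ⬝ᵥ w := rfl
    have h5 : m = b ⬝ᵥ α := rfl
    have h6 : b ⬝ᵥ (α - c • w) = m - c * (k q q - s) := by
      rw [dotProduct_sub, dotProduct_smul, smul_eq_mul, h5, h4]; ring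
    have h7 : ∑ j : Fin n, k q (x' j) * (α - c • w) j = m - c * (k q q - s) := by
      rw [← h6, dotProduct]
      exact Finset.sum_congr rfl fun j _ => by rw [hb, hk.symm]
    have h8 : c * (lam + s) = y (Fin.last n) - m := div_mul_cancel₀ _ hpos.ne'
    simp only [Pi.add_apply, mulVec, dotProduct, gram, of_apply, Fin.sum_univ_castSucc,
      Fin.snoc_castSucc, Fin.snoc_last, Pi.smul_apply, smul_eq_mul]
    change ∑ j : Fin n, k q (x' j) * (α - c • w) j + k q q * c + lam * c = _
    rw [h7]; linarith
  · have h4 := congrFun h3 i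
    simp only [Pi.add_apply, mulVec, dotProduct, gram, of_apply, Fin.sum_univ_castSucc,
      Fin.snoc_castSucc, Fin.snoc_last, Pi.smul_apply, smul_eq_mul, Pi.sub_apply] at h4 ⊢
    change _ + k (x' i) q * c + _ = y' i
    simp only [hb] at h4
    linarith

/-- Adding one sample point changes the self-normalized quadratic form by a function of the new
observation and the posterior at the new point. -/
theorem selfNormSq_succ (hl : 0 < lam) {n : ℕ} (x : Fin (n + 1) → X) (y : Fin (n + 1) → ℝ) :
    selfNormSq k lam x y
      = selfNormSq k lam (fun j : Fin n => x j.castSucc) (fun j => y j.castSucc)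
        + (y (Fin.last n) ^ 2
          - lam * (y (Fin.last n) - postMean k lam (fun j : Fin n => x j.castSucc)
              (fun j => y j.castSucc) (x (Fin.last n))) ^ 2
            / (lam + postCov k lam (fun j : Fin n => x j.castSucc)
                (x (Fin.last n)) (x (Fin.last n)))) := by
  have hsol := hk.inv_mulVec_eq hl x (hk.regGram_succ_mulVec hl x y)
  have hpos : 0 < lam + postCov k lam (fun j : Fin n => x j.castSucc) (x (Fin.last n))
      (x (Fin.last n)) := by
    linarith [hk.postCov_self_nonneg hl (fun j : Fin n => x j.castSucc) (x (Fin.last n))]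
  have hm := hk.dotProduct_inv_comm hl (fun j : Fin n => x j.castSucc)
    (fun j => k (x j.castSucc) (x (Fin.last n))) (fun j => y j.castSucc)
  rw [← postMean_eq] at hm
  have hdot : ∀ (c : ℝ) (u : Fin n → ℝ), y ⬝ᵥ Fin.snoc (α := fun _ => ℝ) u c
      = (fun j : Fin n => y j.castSucc) ⬝ᵥ u + y (Fin.last n) * c := fun c u => by
    simp [dotProduct, Fin.sum_univ_castSucc]
  have hyy : y ⬝ᵥ y = (fun j : Fin n => y j.castSucc) ⬝ᵥ (fun j => y j.castSucc)
      + y (Fin.last n) ^ 2 := by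
    simp [dotProduct, Fin.sum_univ_castSucc, sq]
  rw [selfNormSq, hsol, hdot, hyy, dotProduct_sub, dotProduct_smul, ← hm, selfNormSq, smul_eq_mul]
  field_simp
  ring

/-- Solving for the last basis vector computes the corner entry of the inverse in two ways: as the
reciprocal Schur complement, and by Cramer's rule as the ratio of the old determinant to the new
one. -/
theorem det_regGram_succ (hl : 0 < lam) {n : ℕ} (x : Fin (n + 1) → X) :
    (regGram k lam x).det = (regGram k lam fun j : Fin n => x j.castSucc).det
      * (lam + postCov k lam (fun j : Fin n => x j.castSucc) (x (Fin.last n)) (x (Fin.last n))) := by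
  have hpos : 0 < lam + postCov k lam (fun j : Fin n => x j.castSucc) (x (Fin.last n))
      (x (Fin.last n)) := by
    linarith [hk.postCov_self_nonneg hl (fun j : Fin n => x j.castSucc) (x (Fin.last n))]
  have hdet := (hk.posDef_regGram hl x).det_pos.ne'
  have hsol := hk.inv_mulVec_eq hl x (hk.regGram_succ_mulVec hl x (Pi.single (Fin.last n) 1))
  have h0 : (fun j : Fin n => (Pi.single (Fin.last n) 1 : Fin (n + 1) → ℝ) j.castSucc) = 0 := by
    ext j; simp [Fin.castSucc_ne_last]
  have h1 := congrFun hsol (Fin.last n)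
  rw [h0] at h1
  simp only [postMean_eq, mulVec_zero, dotProduct_zero, Fin.snoc_last, Pi.single_eq_same,
    sub_zero] at h1
  rw [mulVec_single_one, col_apply, inv_def, Matrix.smul_apply, Ring.inverse_eq_inv', smul_eq_mul,
    adjugate_fin_succ_eq_det_submatrix] at h1
  have h2 : (regGram k lam x).submatrix (Fin.last n).succAbove (Fin.last n).succAbove
      = regGram k lam fun j : Fin n => x j.castSucc := by
    ext i j
    simp [regGram, gram, one_apply]
  rw [h2, Fin.val_last, Even.neg_one_pow ⟨n, rfl⟩, one_mul] at h1
  field_simp at h1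
  linarith

/-- The chain rule for information: the logarithm of the determinant factorization, normalized by
powers of `lam`. -/
theorem infoGain_succ (hl : 0 < lam) {n : ℕ} (x : Fin (n + 1) → X) :
    infoGain k lam x = infoGain k lam (fun j : Fin n => x j.castSucc)
      + (1 / 2) * Real.log (1 + postCov k lam (fun j : Fin n => x j.castSucc)
          (x (Fin.last n)) (x (Fin.last n)) / lam) := by
  have hpos := hk.postCov_self_nonneg hl (fun j : Fin n => x j.castSucc) (x (Fin.last n))
  have hd := (hk.posDef_regGram hl fun j : Fin n => x j.castSucc).det_pos
  rw [infoGain, infoGain, det_one_add_smul_gram k hl, det_one_add_smul_gram k hl, hk.det_regGram_succ hl,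
    ← mul_add, ← Real.log_mul (by positivity) (by positivity)]
  congr 2
  have h1 : lam⁻¹ * lam = 1 := inv_mul_cancel₀ hl.ne'
  rw [pow_succ, div_eq_inv_mul]
  linear_combination (lam⁻¹ ^ n * (regGram k lam fun j : Fin n => x j.castSucc).det) * h1

end IsFeatureMap

theorem infoGain_zero (k : X → X → ℝ) (lam : ℝ) (x : Fin 0 → X) : infoGain k lam x = 0 := by
  simp [infoGain]

theorem selfNormSq_zero (k : X → X → ℝ) (lam : ℝ) (x : Fin 0 → X) (e : Fin 0 → ℝ) :
    selfNormSq k lam x e = 0 := by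
  simp [selfNormSq]

end GPAlgebra

/-- The kernel sections are the features, by the reproducing property. From here on only an inner
product space and a feature map are needed. -/
theorem InRKHSBall.exists_isFeatureMap {X : Type} {k : X → X → ℝ} {C : ℝ} {f : X → ℝ}
    (h : InRKHSBall k C f) :
    ∃ (H : Type) (_ : NormedAddCommGroup H) (_ : InnerProductSpace ℝ H) (φ : X → H),
      IsFeatureMap k φ ∧ ∃ F : H, (∀ x, f x = ⟪F, φ x⟫_ℝ) ∧ ‖F‖ ≤ C := by
  obtain ⟨H, i1, i2, i3, i4, hk, F, hF, hC⟩ := h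
  refine ⟨H, i1, i2, fun x => RKHS.kerFun H x (1 : ℝ), fun x y => ?_, F, fun x => ?_, hC⟩
  · rw [← hk, RKHS.kerFun_inner, RKHS.kerFun_apply]; simp
  · rw [RKHS.inner_kerFun, hF]; simp

/-! ### Measurability of the posterior in the sample points and observations -/

section Measurability

variable {α : Type*} {mα : MeasurableSpace α}

theorem measurable_det {n : ℕ} {A : α → Matrix (Fin n) (Fin n) ℝ}
    (hA : ∀ i j, Measurable fun a => A a i j) : Measurable fun a => (A a).det := by
  simp only [det_apply']
  exact Finset.measurable_sum _ fun τ _ =>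
    (Finset.measurable_prod _ fun i _ => hA _ _).const_mul _

/-- By the adjugate formula the entries are cofactors times the inverse determinant. No
invertibility is needed, since inversion on `ℝ` is measurable with value zero at zero. -/
theorem measurable_inv_apply {n : ℕ} {A : α → Matrix (Fin n) (Fin n) ℝ}
    (hA : ∀ i j, Measurable fun a => A a i j) (i j : Fin n) :
    Measurable fun a => (A a)⁻¹ i j := by
  simp only [inv_def, Matrix.smul_apply, Ring.inverse_eq_inv', smul_eq_mul, adjugate_apply]
  refine (measurable_det hA).inv.mul (measurable_det fun i' j' => ?_)
  by_cases h : i' = j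
  · simp [h, updateRow_self]
  · simpa [updateRow_ne h] using hA i' j'

variable {X : Type*} [MeasurableSpace X] {k : X → X → ℝ}

theorem measurable_regGram_inv (hk : Measurable fun p : X × X => k p.1 p.2) (lam : ℝ) {n : ℕ}
    {x : Fin n → α → X} (hx : ∀ j, Measurable (x j)) (i j : Fin n) :
    Measurable fun a => (regGram k lam fun j => x j a)⁻¹ i j := by
  refine measurable_inv_apply (fun i j => ?_) i j
  simp only [regGram, Matrix.add_apply, gram, of_apply]
  exact (hk.comp ((hx i).prodMk (hx j))).add_const _

theorem measurable_postMean (hk : Measurable fun p : X × X => k p.1 p.2) (lam : ℝ) {n : ℕ}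
    {x : Fin n → α → X} (hx : ∀ j, Measurable (x j)) {e : Fin n → α → ℝ}
    (he : ∀ j, Measurable (e j)) {q : α → X} (hq : Measurable q) :
    Measurable fun a => postMean k lam (fun j => x j a) (fun j => e j a) (q a) := by
  simp only [postMean_eq, dotProduct, mulVec]
  exact Finset.measurable_sum _ fun i _ => (hk.comp ((hx i).prodMk hq)).mul
    (Finset.measurable_sum _ fun j _ => (measurable_regGram_inv hk lam hx i j).mul (he j))

theorem measurable_postCov (hk : Measurable fun p : X × X => k p.1 p.2) (lam : ℝ) {n : ℕ}
    {x : Fin n → α → X} (hx : ∀ j, Measurable (x j)) {q : α → X} (hq : Measurable q) :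
    Measurable fun a => postCov k lam (fun j => x j a) (q a) (q a) := by
  simp only [postCov_eq, dotProduct, mulVec]
  exact (hk.comp (hq.prodMk hq)).sub <|
    Finset.measurable_sum _ fun i _ => (hk.comp ((hx i).prodMk hq)).mul
      (Finset.measurable_sum _ fun j _ => (measurable_regGram_inv hk lam hx i j).mul
        (hk.comp ((hx j).prodMk hq)))

end Measurability

/-! ### Gaussian mixtures of exponentials -/

theorem lintegral_exp_quadratic {b : ℝ} (hb : 0 < b) (c d : ℝ) :
    ∫⁻ u : ℝ, ENNReal.ofReal (Real.exp (-b * u ^ 2 + c * u + d))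
      = ENNReal.ofReal (√(Real.pi / b) * Real.exp (d + c ^ 2 / (4 * b))) := by
  have h : ∀ u : ℝ, Real.exp (-b * u ^ 2 + c * u + d)
      = Real.exp (-b * (u - c / (2 * b)) ^ 2) * Real.exp (d + c ^ 2 / (4 * b)) := fun u => by
    rw [← Real.exp_add]; congr 1; field_simp; ring
  have hi := (integrable_exp_neg_mul_sq hb).comp_sub_right (c / (2 * b))
  simp_rw [h]
  rw [← ofReal_integral_eq_lintegral_ofReal (hi.mul_const _)
    (ae_of_all _ fun u => by positivity), integral_mul_const,
    integral_sub_right_eq_self (fun u : ℝ => Real.exp (-b * u ^ 2)), integral_gaussian]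

/-- The exponential moment of the increment of the self-normalized quadratic form. -/
theorem lintegral_exp_increment_le {P : Measure ℝ} [SFinite P] {σ : ℝ} (hσ : 0 < σ)
    (hP : ∀ u : ℝ, ∫⁻ e, ENNReal.ofReal (Real.exp (u * e)) ∂P
      ≤ ENNReal.ofReal (Real.exp (σ ^ 2 * u ^ 2 / 2)))
    {lam s : ℝ} (hl : 0 < lam) (hs : 0 ≤ s) (m : ℝ) :
    ∫⁻ e, ENNReal.ofReal (Real.exp ((e ^ 2 - lam * (e - m) ^ 2 / (lam + s)) / (2 * σ ^ 2)
      - 1 / 2 * Real.log (1 + s / lam))) ∂P ≤ 1 := by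
  rcases hs.eq_or_lt with rfl | hs
  -- With `s = 0` the squares of `e` cancel and the exponent is affine, so sub-Gaussianity applies
  -- directly at `m / σ ^ 2`.
  · have h : ∀ e : ℝ, Real.exp ((e ^ 2 - lam * (e - m) ^ 2 / (lam + 0)) / (2 * σ ^ 2)
        - 1 / 2 * Real.log (1 + 0 / lam))
        = Real.exp (-(m ^ 2 / (2 * σ ^ 2))) * Real.exp (m / σ ^ 2 * e) := fun e => by
      rw [← Real.exp_add]; congr 1
      simp only [zero_div, add_zero, Real.log_one, mul_zero, sub_zero]
      field_simp; ring
    simp_rw [h, ENNReal.ofReal_mul (Real.exp_pos _).le]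
    rw [lintegral_const_mul _ (by fun_prop)]
    refine (mul_le_mul_right (hP _) _).trans ?_
    rw [← ENNReal.ofReal_mul (Real.exp_pos _).le, ← Real.exp_add]
    refine le_of_eq ?_
    rw [ENNReal.ofReal_eq_one, Real.exp_eq_one_iff]
    field_simp; ring
  -- The exponential of the quadratic in `e` is a mixture of `exp (u * e)` with Gaussian weight of
  -- precision parameter `A` centred at `u₀`. After Tonelli, the sub-Gaussian bound lowers the
  -- parameter to `A' = A - σ ^ 2 / 2`. The normalizations then leave `√(A / A') = √(1 + s / lam)`,
  -- which the logarithm in `q` cancels exactly.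
  · set A := σ ^ 2 * (lam + s) / (2 * s) with hA
    set A' := σ ^ 2 * lam / (2 * s) with hA'
    set u₀ := lam * m / (σ ^ 2 * (lam + s)) with hu
    set q := lam * m ^ 2 / (2 * σ ^ 2 * (lam + s)) + 1 / 2 * Real.log (1 + s / lam) with hq
    have hA0 : 0 < A := by positivity
    have hA0' : 0 < A' := by positivity
    have h1 : ∀ e : ℝ, ENNReal.ofReal (Real.exp ((e ^ 2 - lam * (e - m) ^ 2 / (lam + s))
        / (2 * σ ^ 2) - 1 / 2 * Real.log (1 + s / lam)))
        = ENNReal.ofReal ((√(Real.pi / A))⁻¹ * Real.exp (-q)) * ∫⁻ u : ℝ, ENNReal.ofReal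
          (Real.exp (-A * (u - u₀) ^ 2)) * ENNReal.ofReal (Real.exp (u * e)) := fun e => by
      have h2 : ∀ u : ℝ, ENNReal.ofReal (Real.exp (-A * (u - u₀) ^ 2))
          * ENNReal.ofReal (Real.exp (u * e))
          = ENNReal.ofReal (Real.exp (-A * u ^ 2 + (2 * A * u₀ + e) * u + -A * u₀ ^ 2)) :=
        fun u => by
          rw [← ENNReal.ofReal_mul (Real.exp_pos _).le, ← Real.exp_add]; congr 2; ring
      simp_rw [h2]
      rw [lintegral_exp_quadratic hA0, ← ENNReal.ofReal_mul (by positivity)]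
      congr 1
      have h3 : √(Real.pi / A) ≠ 0 := by positivity
      rw [mul_mul_mul_comm, inv_mul_cancel₀ h3, one_mul, ← Real.exp_add]
      congr 1
      rw [hq, hA, hu]; field_simp; ring
    simp_rw [h1]
    rw [lintegral_const_mul _ (by fun_prop), lintegral_lintegral_swap (by fun_prop)]
    have h4 : ∀ u : ℝ, ∫⁻ e, ENNReal.ofReal (Real.exp (-A * (u - u₀) ^ 2))
        * ENNReal.ofReal (Real.exp (u * e)) ∂P
        ≤ ENNReal.ofReal (Real.exp (-A' * u ^ 2 + (2 * A * u₀) * u + -A * u₀ ^ 2)) := fun u => by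
      rw [lintegral_const_mul _ (by fun_prop)]
      refine (mul_le_mul_right (hP _) _).trans (le_of_eq ?_)
      rw [← ENNReal.ofReal_mul (Real.exp_pos _).le, ← Real.exp_add]
      congr 2
      rw [hA', hA]; field_simp; ring
    refine (mul_le_mul_right (lintegral_mono h4) _).trans ?_
    rw [lintegral_exp_quadratic hA0', ← ENNReal.ofReal_mul (by positivity), mul_mul_mul_comm,
      ← Real.exp_add]
    refine le_of_eq ?_
    rw [ENNReal.ofReal_eq_one]
    have h5 : (√(Real.pi / A))⁻¹ * √(Real.pi / A') = Real.exp (1 / 2 * Real.log (1 + s / lam)) := by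
      rw [← Real.sqrt_inv, ← Real.sqrt_mul (by positivity), one_div_mul_eq_div, Real.exp_half,
        Real.exp_log (by positivity)]
      congr 1
      rw [hA, hA']; field_simp
    rw [h5, ← Real.exp_add, Real.exp_eq_one_iff, hq, hA, hA', hu]
    field_simp; ring

/-! ### A maximal inequality for products -/

section Maximal

variable {Ω : Type*} {mΩ : MeasurableSpace Ω} {μ : Measure Ω}

/-- The running product of `R`, stopped when it reaches `c`. -/
def stoppedProd (R : ℕ → Ω → ℝ≥0∞) (c : ℝ≥0∞) : ℕ → Ω → ℝ≥0∞
  | 0, _ => 1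
  | n + 1, ω => if c ≤ stoppedProd R c n ω then stoppedProd R c n ω
      else stoppedProd R c n ω * R n ω

/-- The stopped product follows the running product until it reaches `c` and is frozen afterwards,
so one visit above `c` is remembered at time `T`. -/
theorem le_stoppedProd {R : ℕ → Ω → ℝ≥0∞} {c : ℝ≥0∞} {n T : ℕ} {ω : Ω} (hn : n ≤ T)
    (h : c ≤ ∏ t ∈ Finset.range n, R t ω) : c ≤ stoppedProd R c T ω := by
  have hstay : ∀ m, c ≤ stoppedProd R c m ω → c ≤ stoppedProd R c (m + 1) ω := fun m hm => by
    simp [stoppedProd, hm]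
  have key : ∀ m, c ≤ stoppedProd R c m ω
      ∨ stoppedProd R c m ω = ∏ t ∈ Finset.range m, R t ω := fun m => by
    induction m with
    | zero => right; simp [stoppedProd]
    | succ m ih =>
      by_cases hm : c ≤ stoppedProd R c m ω
      · exact Or.inl (hstay m hm)
      · right
        rw [Finset.prod_range_succ, ← ih.resolve_left hm]
        simp [stoppedProd, hm]
  have hcn : c ≤ stoppedProd R c n ω := by
    rcases key n with h' | h'
    · exact h'
    · rwa [h']
  induction T, hn using Nat.le_induction with
  | base => exact hcn
  | succ m _ ih => exact hstay m ih

/-- Ville's inequality: stopping preserves the supermartingale property, and Markov's inequality is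
applied at the terminal time. Testing against nonnegative past-measurable weights `W` replaces
conditional expectations and their integrability conditions. -/
theorem mul_measure_exists_prod_ge_le (𝒢 : Filtration ℕ mΩ) {R : ℕ → Ω → ℝ≥0∞} {T : ℕ}
    (hmeas : ∀ t < T, Measurable[𝒢 (t + 1)] (R t))
    (hR : ∀ t < T, ∀ W : Ω → ℝ≥0∞, Measurable[𝒢 t] W → ∫⁻ ω, W ω * R t ω ∂μ ≤ ∫⁻ ω, W ω ∂μ)
    (c : ℝ≥0∞) :
    c * μ {ω | ∃ n ≤ T, c ≤ ∏ t ∈ Finset.range n, R t ω} ≤ μ Set.univ := by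
  have hN : ∀ n ≤ T, Measurable[𝒢 n] (stoppedProd R c n) ∧
      ∫⁻ ω, stoppedProd R c n ω ∂μ ≤ μ Set.univ := fun n => by
    induction n with
    | zero => exact fun _ => ⟨@measurable_const _ _ _ (𝒢 0) 1, by simp [stoppedProd]⟩
    | succ n ih =>
      intro hn
      obtain ⟨h1, h2⟩ := ih (by omega)
      have hset : MeasurableSet[𝒢 n] {ω | c ≤ stoppedProd R c n ω} :=
        h1 measurableSet_Ici
      have hmono := 𝒢.mono n.le_succ
      refine ⟨?_, ?_⟩
      · have h3 := h1.mono hmono le_rfl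
        exact Measurable.ite (hmono _ hset) h3 (h3.mul (hmeas n (by omega)))
      · refine le_trans ?_ h2
        have hW := h1.indicator hset.compl
        have hA := h1.indicator hset
        -- Only the part not yet stopped is multiplied by the new factor; its weight is measurable
        -- at time `n`, so `hR` applies to it.
        have e1 : ∀ ω, stoppedProd R c (n + 1) ω
            = {ω | c ≤ stoppedProd R c n ω}.indicator (stoppedProd R c n) ω
              + {ω | c ≤ stoppedProd R c n ω}ᶜ.indicator (stoppedProd R c n) ω * R n ω :=
          fun ω => by
            by_cases h : c ≤ stoppedProd R c n ω <;> simp [stoppedProd, h]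
        have e2 : ∀ ω, stoppedProd R c n ω
            = {ω | c ≤ stoppedProd R c n ω}.indicator (stoppedProd R c n) ω
              + {ω | c ≤ stoppedProd R c n ω}ᶜ.indicator (stoppedProd R c n) ω := fun ω => by
          by_cases h : c ≤ stoppedProd R c n ω <;> simp [h]
        have hA' := hA.mono (𝒢.le n) le_rfl
        calc ∫⁻ ω, stoppedProd R c (n + 1) ω ∂μ
            = _ := lintegral_congr e1
          _ = _ := lintegral_add_left hA' _
          _ ≤ _ := by gcongr ?_ + ?_; exacts [le_rfl, hR n (by omega) _ hW]
          _ = _ := (lintegral_add_left hA' _).symm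
          _ = ∫⁻ ω, stoppedProd R c n ω ∂μ := (lintegral_congr e2).symm
  obtain ⟨h1, h2⟩ := hN T le_rfl
  refine le_trans ?_ ((mul_meas_ge_le_lintegral (h1.mono (𝒢.le T) le_rfl) c).trans h2)
  refine mul_le_mul_right (measure_mono ?_) c
  rintro ω ⟨n, hn, h⟩
  exact le_stoppedProd hn h

end Maximal

/-- Freezing: by independence the joint law is a product, so the noise can be integrated first with
the past held fixed. -/
theorem lintegral_mul_comp_le_of_indep {Ω : Type*} {m mΩ : MeasurableSpace Ω}
    {μ : Measure Ω} [IsFiniteMeasure μ] (hm : m ≤ mΩ)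
    {β : Type*} [MeasurableSpace β] {Y : Ω → β} (hY : Measurable[m] Y) {e : Ω → ℝ}
    (he : Measurable e) (hind : Indep (MeasurableSpace.comap e inferInstance) m μ)
    {ψ : β × ℝ → ℝ≥0∞} (hψ : Measurable ψ)
    (hle : ∀ ω, ∫⁻ r, ψ (Y ω, r) ∂(μ.map e) ≤ 1) {W : Ω → ℝ≥0∞} (hW : Measurable[m] W) :
    ∫⁻ ω, W ω * ψ (Y ω, e ω) ∂μ ≤ ∫⁻ ω, W ω ∂μ := by
  have hZ : Measurable[m] fun ω => (W ω, Y ω) := hW.prodMk hY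
  have hZ' : Measurable fun ω => (W ω, Y ω) := hZ.mono hm le_rfl
  have hif : IndepFun (fun ω => (W ω, Y ω)) e μ := by
    rw [IndepFun_iff_Indep]
    exact (indep_of_indep_of_le_right hind hZ.comap_le).symm
  rw [indepFun_iff_map_prod_eq_prod_map_map hZ'.aemeasurable he.aemeasurable] at hif
  have hg : Measurable fun p : (ℝ≥0∞ × β) × ℝ => p.1.1 * ψ (p.1.2, p.2) := by fun_prop
  calc ∫⁻ ω, W ω * ψ (Y ω, e ω) ∂μ
      = ∫⁻ p, p.1.1 * ψ (p.1.2, p.2) ∂(μ.map fun ω => ((W ω, Y ω), e ω)) :=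
        (lintegral_map hg (hZ'.prodMk he)).symm
    _ = ∫⁻ w, ∫⁻ r, w.1 * ψ (w.2, r) ∂(μ.map e) ∂(μ.map fun ω => (W ω, Y ω)) := by
        rw [hif, lintegral_prod _ hg.aemeasurable]
    _ = ∫⁻ ω, ∫⁻ r, W ω * ψ (Y ω, r) ∂(μ.map e) ∂μ :=
        lintegral_map (Measurable.lintegral_prod_right' hg) hZ'
    _ ≤ ∫⁻ ω, W ω ∂μ := lintegral_mono fun ω => by
        rw [lintegral_const_mul _ (by fun_prop)]
        exact (mul_le_mul_right (hle ω) _).trans (mul_one _).le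

/-! ### The self-normalized concentration inequality -/

section Concentration

variable {Ω : Type*} {mΩ : MeasurableSpace Ω} {μ : Measure Ω} [IsProbabilityMeasure μ]
variable {X : Type*} [MeasurableSpace X] {k : X → X → ℝ}
variable {H : Type*} [NormedAddCommGroup H] [InnerProductSpace ℝ H] {φ : X → H}

/-- The recursions for `selfNormSq` and `infoGain` make the exponential a product of one-step
factors, to which the maximal inequality applies at level `1 / δ`. -/
theorem measure_selfNormSq_gt_le_of_pos (hk : IsFeatureMap k φ)
    (hkm : Measurable fun p : X × X => k p.1 p.2) {lam : ℝ} (hl : 0 < lam) {T : ℕ}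
    {ℱ : Filtration ℕ mΩ} {x : ℕ → Ω → X} {e : ℕ → Ω → ℝ} {σ : ℝ≥0} (hσ : 0 < σ)
    (hx : ∀ t ∈ Finset.Icc 1 T, Measurable[ℱ t] (x t))
    (he : ∀ t ∈ Finset.Icc 1 T, Measurable[ℱ (t + 1)] (e t))
    (hsub : ∀ t ∈ Finset.Icc 1 T, HasSubgaussianMGF (e t) (σ ^ 2) μ)
    (hind : ∀ t ∈ Finset.Icc 1 T, Indep (MeasurableSpace.comap (e t) inferInstance) (ℱ t) μ)
    {δ : ℝ} (hδ : 0 < δ) :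
    μ {ω | ¬ ∀ n ≤ T, selfNormSq k lam (fun j : Fin n => x (j + 1) ω) (fun j => e (j + 1) ω)
        ≤ 2 * σ ^ 2 * (infoGain k lam (fun j : Fin n => x (j + 1) ω) + Real.log (1 / δ))}
      ≤ ENNReal.ofReal δ := by
  have hσ' : (0 : ℝ) < σ := hσ
  let m : ℕ → Ω → ℝ := fun t ω => postMean k lam (fun j : Fin t => x (j + 1) ω)
    (fun j => e (j + 1) ω) (x (t + 1) ω)
  let s : ℕ → Ω → ℝ := fun t ω => postCov k lam (fun j : Fin t => x (j + 1) ω)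
    (x (t + 1) ω) (x (t + 1) ω)
  let ψ : (ℝ × ℝ) × ℝ → ℝ≥0∞ := fun p => ENNReal.ofReal
    (Real.exp ((p.2 ^ 2 - lam * (p.2 - p.1.1) ^ 2 / (lam + p.1.2)) / (2 * (σ : ℝ) ^ 2)
      - 1 / 2 * Real.log (1 + p.1.2 / lam)))
  have hψ : Measurable ψ := by fun_prop
  let R : ℕ → Ω → ℝ≥0∞ := fun t ω => ψ ((m t ω, s t ω), e (t + 1) ω)
  -- The shift by one makes the factor with index `t` use the point `x (t + 1)`, known at time `t`
  -- of `𝒢`, and the noise `e (t + 1)`, independent of it.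
  let 𝒢 : Filtration ℕ mΩ :=
    ⟨fun t => ℱ (t + 1), fun i j h => ℱ.mono (Nat.succ_le_succ h), fun t => ℱ.le _⟩
  have hmem : ∀ t < T, t + 1 ∈ Finset.Icc 1 T := fun t ht => Finset.mem_Icc.2 ⟨by omega, by omega⟩
  have hpts : ∀ t < T, ∀ j : Fin t, Measurable[𝒢 t] (x (j + 1)) := fun t ht j =>
    (hx _ (hmem j (by omega))).mono (ℱ.mono (by omega)) le_rfl
  have hnoise : ∀ t < T, ∀ j : Fin t, Measurable[𝒢 t] (e (j + 1)) := fun t ht j =>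
    (he _ (hmem j (by omega))).mono (ℱ.mono (by omega)) le_rfl
  have hY : ∀ t < T, Measurable[𝒢 t] fun ω => (m t ω, s t ω) := fun t ht =>
    (measurable_postMean hkm lam (hpts t ht) (hnoise t ht) (hx _ (hmem t ht))).prodMk
      (measurable_postCov hkm lam (hpts t ht) (hx _ (hmem t ht)))
  have hprod : ∀ n ω, ∏ t ∈ Finset.range n, R t ω = ENNReal.ofReal (Real.exp
      (selfNormSq k lam (fun j : Fin n => x (j + 1) ω) (fun j => e (j + 1) ω) / (2 * (σ : ℝ) ^ 2)
        - infoGain k lam (fun j : Fin n => x (j + 1) ω))) := fun n ω => by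
    induction n with
    | zero => simp [selfNormSq_zero, infoGain_zero]
    | succ n ih =>
      rw [Finset.prod_range_succ, ih, hk.selfNormSq_succ hl, hk.infoGain_succ hl]
      simp only [R, ψ]
      rw [← ENNReal.ofReal_mul (Real.exp_pos _).le, ← Real.exp_add]
      congr 2
      simp only [m, s, Fin.val_castSucc, Fin.val_last]
      ring
  have hmax := mul_measure_exists_prod_ge_le (μ := μ) 𝒢 (R := R) (T := T)
    (fun t ht => hψ.comp (((hY t ht).mono (𝒢.mono t.le_succ) le_rfl).prodMk
      (he _ (hmem t ht))))
    (fun t ht W hW => lintegral_mul_comp_le_of_indep (ℱ.le _) (hY t ht)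
      ((he _ (hmem t ht)).mono (ℱ.le _) le_rfl) (hind _ (hmem t ht)) hψ (fun ω => by
        have hem : Measurable (e (t + 1)) := (he _ (hmem t ht)).mono (ℱ.le _) le_rfl
        refine lintegral_exp_increment_le hσ' (fun u => ?_) hl
          (hk.postCov_self_nonneg hl _ _) (m t ω)
        have hs := hsub _ (hmem t ht)
        rw [lintegral_map (by fun_prop) hem,
          ← ofReal_integral_eq_lintegral_ofReal (hs.integrable_exp_mul u)
            (ae_of_all _ fun _ => (Real.exp_pos _).le)]
        refine ENNReal.ofReal_le_ofReal ?_
        simpa [mgf] using hs.mgf_le u) hW) (ENNReal.ofReal (1 / δ))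
  rw [measure_univ] at hmax
  have hsub' : {ω | ¬ ∀ n ≤ T, selfNormSq k lam (fun j : Fin n => x (j + 1) ω)
        (fun j => e (j + 1) ω)
        ≤ 2 * σ ^ 2 * (infoGain k lam (fun j : Fin n => x (j + 1) ω) + Real.log (1 / δ))}
      ⊆ {ω | ∃ n ≤ T, ENNReal.ofReal (1 / δ) ≤ ∏ t ∈ Finset.range n, R t ω} := by
    intro ω hω
    simp only [Set.mem_ofPred_eq, not_forall, not_le] at hω
    obtain ⟨n, hn, h⟩ := hω
    refine ⟨n, hn, ?_⟩
    rw [hprod]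
    refine ENNReal.ofReal_le_ofReal ?_
    rw [← Real.log_le_iff_le_exp (by positivity), le_sub_iff_add_le, le_div_iff₀ (by positivity)]
    linarith
  refine (measure_mono hsub').trans ?_
  have h1 : ENNReal.ofReal δ * ENNReal.ofReal (1 / δ) = 1 := by
    rw [← ENNReal.ofReal_mul hδ.le, mul_one_div_cancel hδ.ne', ENNReal.ofReal_one]
  calc μ {ω | ∃ n ≤ T, ENNReal.ofReal (1 / δ) ≤ ∏ t ∈ Finset.range n, R t ω}
      = ENNReal.ofReal δ * (ENNReal.ofReal (1 / δ)
        * μ {ω | ∃ n ≤ T, ENNReal.ofReal (1 / δ) ≤ ∏ t ∈ Finset.range n, R t ω}) := by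
        rw [← mul_assoc, h1, one_mul]
    _ ≤ ENNReal.ofReal δ * 1 := by gcongr
    _ = ENNReal.ofReal δ := mul_one _

/-- Simultaneously for all numbers of samples, the self-normalized quadratic form of sub-Gaussian
noise is bounded by the information gain. -/
theorem measure_selfNormSq_gt_le (hk : IsFeatureMap k φ)
    (hkm : Measurable fun p : X × X => k p.1 p.2) {lam : ℝ} (hl : 0 < lam) {T : ℕ}
    {ℱ : Filtration ℕ mΩ} {x : ℕ → Ω → X} {e : ℕ → Ω → ℝ} {σ : ℝ≥0}
    (hx : ∀ t ∈ Finset.Icc 1 T, Measurable[ℱ t] (x t))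
    (he : ∀ t ∈ Finset.Icc 1 T, Measurable[ℱ (t + 1)] (e t))
    (hsub : ∀ t ∈ Finset.Icc 1 T, HasSubgaussianMGF (e t) (σ ^ 2) μ)
    (hind : ∀ t ∈ Finset.Icc 1 T, Indep (MeasurableSpace.comap (e t) inferInstance) (ℱ t) μ)
    {δ : ℝ} (hδ : 0 < δ) :
    μ {ω | ¬ ∀ n ≤ T, selfNormSq k lam (fun j : Fin n => x (j + 1) ω) (fun j => e (j + 1) ω)
        ≤ 2 * σ ^ 2 * (infoGain k lam (fun j : Fin n => x (j + 1) ω) + Real.log (1 / δ))}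
      ≤ ENNReal.ofReal δ := by
  -- For `σ = 0` the exponential process would divide by zero, but the noise vanishes almost surely.
  rcases (zero_le (a := σ)).eq_or_lt with rfl | hσ
  · have h0 : ∀ᵐ ω ∂μ, ∀ t ∈ Finset.Icc 1 T, e t ω = 0 := by
      refine (Finset.eventually_all _).2 fun t ht => ?_
      have := hsub t ht
      rw [zero_pow two_ne_zero] at this
      exact this.ae_eq_zero_of_hasSubgaussianMGF_zero
    refine le_trans (le_of_eq (ae_iff.1 ?_)) zero_le
    filter_upwards [h0] with ω hω n hn
    have : (fun j : Fin n => e (j + 1) ω) = 0 :=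
      funext fun j => hω _ (Finset.mem_Icc.2 ⟨by omega, by omega⟩)
    simp [this, selfNormSq]
  · exact measure_selfNormSq_gt_le_of_pos hk hkm hl hσ hx he hsub hind hδ

end Concentration

/-! ### Information gain -/

namespace IsFeatureMap

variable {X : Type*} {H : Type*} [NormedAddCommGroup H] [InnerProductSpace ℝ H]
variable {k : X → X → ℝ} {φ : X → H} (hk : IsFeatureMap k φ) {lam : ℝ} {D : Set X}
include hk

/-- A crude bound, needed so that the real supremum in `maxInfoGain` is over a bounded set and does
not take its default value. -/
theorem infoGain_le (hl : 0 < lam) (hD : ∀ p ∈ D, k p p ≤ 1) {n : ℕ} (x : Fin n → X)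
    (hx : ∀ j, x j ∈ D) : infoGain k lam x ≤ n * (1 / 2 * Real.log (1 + 1 / lam)) := by
  induction n with
  | zero => simp [infoGain_zero]
  | succ n ih =>
    rw [hk.infoGain_succ hl]
    have h1 := ih (fun j => x j.castSucc) fun j => hx _
    have h0 := hk.postCov_self_nonneg hl (fun j : Fin n => x j.castSucc) (x (Fin.last n))
    have h2 := (hk.postCov_self_le hl (fun j : Fin n => x j.castSucc) (x (Fin.last n))).trans
      (hD _ (hx _))
    have h3 : Real.log (1 + postCov k lam (fun j : Fin n => x j.castSucc) (x (Fin.last n))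
        (x (Fin.last n)) / lam) ≤ Real.log (1 + 1 / lam) := by
      gcongr
    push_cast
    linarith

theorem infoGain_castSucc_le (hl : 0 < lam) {n : ℕ} (x : Fin (n + 1) → X) :
    infoGain k lam (fun j : Fin n => x j.castSucc) ≤ infoGain k lam x := by
  rw [hk.infoGain_succ hl]
  have h0 := hk.postCov_self_nonneg hl (fun j : Fin n => x j.castSucc) (x (Fin.last n))
  have : 0 ≤ Real.log (1 + postCov k lam (fun j : Fin n => x j.castSucc) (x (Fin.last n))
      (x (Fin.last n)) / lam) := Real.log_nonneg (by linarith [div_nonneg h0 hl.le])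
  linarith

theorem infoGain_le_maxInfoGain (hl : 0 < lam) (hD : ∀ p ∈ D, k p p ≤ 1) {n : ℕ} (x : Fin n → X)
    (hx : ∀ j, x j ∈ D) : infoGain k lam x ≤ maxInfoGain k lam D n := by
  have hb : BddAbove (Set.range fun A : Fin n → D => infoGain k lam fun j => (A j : X)) := by
    refine ⟨n * (1 / 2 * Real.log (1 + 1 / lam)), ?_⟩
    rintro _ ⟨A, rfl⟩
    exact hk.infoGain_le hl hD _ fun j => (A j).2
  exact le_ciSup hb fun j => (⟨x j, hx j⟩ : D)

/-- Extending a tuple by any fixed point of `D` cannot lower its information gain. -/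
theorem maxInfoGain_mono (hl : 0 < lam) (hD : ∀ p ∈ D, k p p ≤ 1) (hne : D.Nonempty) :
    Monotone (maxInfoGain k lam D) := by
  obtain ⟨p, hp⟩ := hne
  have : Nonempty D := ⟨⟨p, hp⟩⟩
  refine monotone_nat_of_le_succ fun n => ciSup_le fun A => ?_
  have hmem : ∀ j, (Fin.snoc (α := fun _ => X) (fun j => (A j : X)) p : Fin (n + 1) → X) j ∈ D :=
    Fin.lastCases (by simpa using hp) fun j => by simp
  have h1 := hk.infoGain_castSucc_le hl
    (Fin.snoc (α := fun _ => X) (fun j => (A j : X)) p : Fin (n + 1) → X)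
  simp only [Fin.snoc_castSucc] at h1
  exact h1.trans (hk.infoGain_le_maxInfoGain hl hD _ hmem)

theorem maxInfoGain_nonneg (hl : 0 < lam) (hD : ∀ p ∈ D, k p p ≤ 1) (hne : D.Nonempty) (n : ℕ) :
    0 ≤ maxInfoGain k lam D n := by
  have h := hk.infoGain_le_maxInfoGain hl hD (n := 0) Fin.elim0 fun j => j.elim0
  rw [infoGain_zero] at h
  exact h.trans (hk.maxInfoGain_mono hl hD hne n.zero_le)

theorem half_log_le_maxInfoGain (hl : 0 < lam) (hD : ∀ p ∈ D, k p p ≤ 1) {p : X} (hp : p ∈ D)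
    {n : ℕ} (hn : 1 ≤ n) : 1 / 2 * Real.log (1 + k p p / lam) ≤ maxInfoGain k lam D n := by
  have h := hk.infoGain_le_maxInfoGain hl hD (n := 1) (fun _ => p) fun _ => hp
  rw [hk.infoGain_succ hl, infoGain_zero, zero_add] at h
  have h0 : postCov k lam (fun _ : Fin 0 => p) p p = k p p := by simp [postCov_eq]
  rw [h0] at h
  exact h.trans (hk.maxInfoGain_mono hl hD ⟨p, hp⟩ hn)

/-- Since `s ≤ 1` and `lam ≤ 3`, `log (1 + s / lam) ≥ s / (lam + s) ≥ s / 4`. The factor `8` is this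
`4` times the `2` from the one half in the information gain. -/
theorem sum_postCov_le (hl : 0 < lam) (hl3 : lam ≤ 3) (hD : ∀ p ∈ D, k p p ≤ 1) (x : ℕ → X)
    (n : ℕ) (hx : ∀ j < n, x (j + 1) ∈ D) :
    ∑ t ∈ Finset.range n, postCov k lam (fun j : Fin t => x (j + 1)) (x (t + 1)) (x (t + 1))
      ≤ 8 * infoGain k lam (fun j : Fin n => x (j + 1)) := by
  induction n with
  | zero => simp [infoGain_zero]
  | succ n ih =>
    rw [Finset.sum_range_succ, hk.infoGain_succ hl]
    have h1 := ih fun j hj => hx j (by omega)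
    simp only [Fin.val_castSucc, Fin.val_last]
    have h0 := hk.postCov_self_nonneg hl (fun j : Fin n => x (j + 1)) (x (n + 1))
    have h2 := (hk.postCov_self_le hl (fun j : Fin n => x (j + 1)) (x (n + 1))).trans
      (hD _ (hx n (by omega)))
    set s := postCov k lam (fun j : Fin n => x (j + 1)) (x (n + 1)) (x (n + 1))
    have h3 : s / 4 ≤ Real.log (1 + s / lam) := by
      refine le_trans ?_ (Real.one_sub_inv_le_log_of_pos (by positivity))
      have h4 : 1 - (1 + s / lam)⁻¹ = s / (lam + s) := by field_simp; ring
      rw [h4]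
      gcongr
      linarith
    linarith

theorem sum_postStd_le (hl : 0 < lam) (hl3 : lam ≤ 3) (hD : ∀ p ∈ D, k p p ≤ 1) (x : ℕ → X)
    (n : ℕ) (hx : ∀ j < n, x (j + 1) ∈ D) :
    ∑ t ∈ Finset.range n, postStd k lam (fun j : Fin t => x (j + 1)) (x (t + 1))
      ≤ √(8 * (n * maxInfoGain k lam D n)) := by
  refine Real.le_sqrt_of_sq_le ?_
  refine sq_sum_le_card_mul_sum_sq.trans ?_
  rw [Finset.card_range]
  simp only [hk.postStd_sq hl]
  have h1 := hk.sum_postCov_le hl hl3 hD x n hx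
  have h2 := hk.infoGain_le_maxInfoGain hl hD (fun j : Fin n => x (j + 1)) fun j => hx j j.2
  nlinarith [(Nat.cast_nonneg n : (0 : ℝ) ≤ n)]

end IsFeatureMap

theorem postMean_add {X : Type*} (k : X → X → ℝ) (lam : ℝ) {n : ℕ} (x : Fin n → X)
    (y e : Fin n → ℝ) (p : X) :
    postMean k lam x (fun j => y j + e j) p = postMean k lam x y p + postMean k lam x e p := by
  have : (fun j => y j + e j) = y + e := rfl
  rw [this, postMean_eq, postMean_eq, postMean_eq, mulVec_add, dotProduct_add]

theorem postStd_nonneg {X : Type*} (k : X → X → ℝ) (lam : ℝ) {n : ℕ} (x : Fin n → X) (p : X) :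
    0 ≤ postStd k lam x p := Real.sqrt_nonneg _

theorem sum_Icc_one_eq_sum_range (F : ℕ → ℝ) (T : ℕ) :
    ∑ t ∈ Finset.Icc 1 T, F t = ∑ t ∈ Finset.range T, F (t + 1) := by
  rw [Finset.range_eq_Ico, Finset.sum_Ico_add' F 0 T 1, zero_add]
  rfl

/-! ### Consequences of the standing assumptions -/

namespace Setting

variable {nθ nz N : ℕ} {S : Setting nθ nz N} {P : Params N}

namespace Regular

variable (hS : S.Regular P) {lam : ℝ}
include hS

theorem dom_nonempty : S.dom.Nonempty := by
  obtain ⟨z, hz⟩ := hS.nonempty_Z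
  obtain ⟨θ, hθ, -⟩ := hS.slater z hz
  exact ⟨(θ, z), hθ, hz⟩

theorem C_nonneg (i : Fin (N + 1)) : 0 ≤ P.C i := by
  obtain ⟨H, _, _, φ, -, F, -, hF⟩ := (hS.rkhs i).exists_isFeatureMap
  exact (norm_nonneg F).trans hF

theorem abs_fn_le_mul_sqrt (i : Fin (N + 1)) (p : Pt nθ nz) :
    |S.fn i p| ≤ P.C i * √(S.k i p p) := by
  obtain ⟨H, _, _, φ, hk, F, hF, hC⟩ := (hS.rkhs i).exists_isFeatureMap
  rw [hF, hk, ← norm_eq_sqrt_real_inner]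
  exact (abs_real_inner_le_norm F (φ p)).trans (by gcongr)

theorem abs_fn_le (i : Fin (N + 1)) {p : Pt nθ nz} (hp : p ∈ S.dom) : |S.fn i p| ≤ P.C i := by
  have h1 : √(S.k i p p) ≤ 1 := Real.sqrt_le_one.2 (hS.normalized i p hp)
  exact (hS.abs_fn_le_mul_sqrt i p).trans (mul_le_of_le_one_right (hS.C_nonneg i) h1)

/-- At a Slater point the constraint has absolute value at least `ξ`, while the normalized kernel
bounds it by its norm bound. This makes the norm bounds of the constraints positive and gives `ε ≤ C
i` in the drift estimate. -/
theorem slater_le_C (i : Fin N) : P.ξ ≤ P.C i.succ := by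
  obtain ⟨z, hz⟩ := hS.nonempty_Z
  obtain ⟨θ, hθ, h⟩ := hS.slater z hz
  have h1 := hS.abs_fn_le i.succ (p := (θ, z)) ⟨hθ, hz⟩
  have h2 := h i
  have h3 : S.fn i.succ (θ, z) = S.g i (θ, z) := rfl
  rw [h3] at h1
  linarith [neg_abs_le (S.g i (θ, z))]

theorem γ_mono (hl : 0 < lam) (i : Fin (N + 1)) : Monotone (S.γ lam i) := by
  obtain ⟨H, _, _, φ, hk, -⟩ := (hS.rkhs i).exists_isFeatureMap
  exact hk.maxInfoGain_mono hl (hS.normalized i) hS.dom_nonempty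

theorem γ_nonneg (hl : 0 < lam) (i : Fin (N + 1)) (t : ℕ) : 0 ≤ S.γ lam i t := by
  obtain ⟨H, _, _, φ, hk, -⟩ := (hS.rkhs i).exists_isFeatureMap
  exact hk.maxInfoGain_nonneg hl (hS.normalized i) hS.dom_nonempty t

/-- Slater's condition bounds the information gains of the constraints from below. -/
theorem le_γ_succ (hξ : 0 < P.ξ) (hl : 0 < lam) (hl3 : lam ≤ 3) (i : Fin N) {t : ℕ} (ht : 1 ≤ t) :
    1 / 2 * Real.log (1 + (P.ξ / P.C i.succ) ^ 2 / 3) ≤ S.γ lam i.succ t := by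
  obtain ⟨z, hz⟩ := hS.nonempty_Z
  obtain ⟨θ, hθ, h⟩ := hS.slater z hz
  obtain ⟨H, _, _, φ, hk, -⟩ := (hS.rkhs i.succ).exists_isFeatureMap
  have hp : (θ, z) ∈ S.dom := ⟨hθ, hz⟩
  refine le_trans ?_ (hk.half_log_le_maxInfoGain hl (hS.normalized i.succ) hp ht)
  have hC : 0 < P.C i.succ := hξ.trans_le (hS.slater_le_C i)
  have hk0 := hk.diag_nonneg (θ, z)
  have h1 : P.ξ ≤ P.C i.succ * √(S.k i.succ (θ, z) (θ, z)) := by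
    refine le_trans ?_ (hS.abs_fn_le_mul_sqrt i.succ (θ, z))
    have h2 := h i
    have h3 : S.fn i.succ (θ, z) = S.g i (θ, z) := rfl
    rw [h3]
    linarith [neg_abs_le (S.g i (θ, z))]
  -- A function of bounded norm can reach size `ξ` at the Slater point only if the kernel is not too
  -- small there.
  have h4 : (P.ξ / P.C i.succ) ^ 2 ≤ S.k i.succ (θ, z) (θ, z) := by
    rw [← Real.sq_sqrt hk0]
    gcongr
    rwa [div_le_iff₀' hC]
  gcongr

theorem sqrtBeta_nonneg (i : Fin (N + 1)) (t : ℕ) : 0 ≤ sqrtBeta S P lam i t := by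
  have := hS.C_nonneg i
  unfold sqrtBeta
  positivity

theorem sqrtBeta_mono (hl : 0 < lam) (i : Fin (N + 1)) : Monotone (sqrtBeta S P lam i) := by
  intro t T h
  unfold sqrtBeta
  have := hS.γ_mono hl i (Nat.sub_le_sub_right h 1)
  gcongr

theorem sum_postStd_le (hl : 0 < lam) (hl3 : lam ≤ 3) (i : Fin (N + 1)) {T : ℕ}
    {x : ℕ → Pt nθ nz} (hx : ∀ t ∈ Finset.Icc 1 T, x t ∈ S.dom) :
    ∑ t ∈ Finset.Icc 1 T, postStd (S.k i) lam (fun j : Fin (t - 1) => x (j + 1)) (x t)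
      ≤ √(8 * (T * S.γ lam i T)) := by
  obtain ⟨H, _, _, φ, hk, -⟩ := (hS.rkhs i).exists_isFeatureMap
  rw [sum_Icc_one_eq_sum_range]
  exact hk.sum_postStd_le hl hl3 (hS.normalized i) x T fun j hj =>
    hx _ (Finset.mem_Icc.2 ⟨by omega, by omega⟩)

/-- Confidence bounds hold whenever the self-normalized quadratic form of the noise is bounded. -/
theorem mem_Icc_lcb_ucb (hδ : P.δ ∈ Set.Ioo (0 : ℝ) 1) (hl : 1 ≤ lam) (i : Fin (N + 1)) {t : ℕ}
    {x : ℕ → Pt nθ nz} {y : Fin (N + 1) → ℕ → ℝ} {e : ℕ → ℝ}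
    (hy : ∀ j, y i j = S.fn i (x j) + e j) (hx : ∀ j : Fin (t - 1), x (j + 1) ∈ S.dom)
    (he : selfNormSq (S.k i) lam (fun j : Fin (t - 1) => x (j + 1)) (fun j => e (j + 1))
      ≤ 2 * P.σ ^ 2 * (infoGain (S.k i) lam (fun j : Fin (t - 1) => x (j + 1))
        + Real.log (((N : ℝ) + 1) / P.δ)))
    {p : Pt nθ nz} (hp : p ∈ S.dom) :
    S.fn i p ∈ Set.Icc (lcb S P lam x y i t p) (ucb S P lam x y i t p) := by
  obtain ⟨H, _, _, φ, hk, F, hF, hC⟩ := (hS.rkhs i).exists_isFeatureMap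
  have hl0 : 0 < lam := by linarith
  have hL : 0 ≤ Real.log (((N : ℝ) + 1) / P.δ) := by
    refine Real.log_nonneg ((one_le_div₀ hδ.1).2 ?_)
    have : (0 : ℝ) ≤ N := Nat.cast_nonneg N
    linarith [hδ.2]
  have hstd := postStd_nonneg (S.k i) lam (fun j : Fin (t - 1) => x (j + 1)) p
  have hbias := hk.abs_sub_postMean_le hl0 (fun j : Fin (t - 1) => x (j + 1)) F p
  have hnoise := hk.abs_postMean_le hl0 (fun j : Fin (t - 1) => x (j + 1)) (fun j => e (j + 1)) p
  have hmean : postMean (S.k i) lam (fun j : Fin (t - 1) => x (j + 1)) (fun j => y i (j + 1)) p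
      = postMean (S.k i) lam (fun j : Fin (t - 1) => x (j + 1))
          (fun j => ⟪F, φ (x (j + 1))⟫_ℝ) p
        + postMean (S.k i) lam (fun j : Fin (t - 1) => x (j + 1)) (fun j => e (j + 1)) p := by
    rw [← postMean_add]
    simp only [hy, hF]
  have hgain := hk.infoGain_le_maxInfoGain hl0 (hS.normalized i)
    (fun j : Fin (t - 1) => x (j + 1)) hx
  have hq : √(selfNormSq (S.k i) lam (fun j : Fin (t - 1) => x (j + 1)) (fun j => e (j + 1)) / lam)
      ≤ P.σ * √(2 * (S.γ lam i (t - 1) + 1 + Real.log (((N : ℝ) + 1) / P.δ))) := by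
    have hγ := hS.γ_nonneg hl0 i (t - 1)
    refine Real.sqrt_le_iff.2 ⟨by positivity, ?_⟩
    rw [mul_pow, Real.sq_sqrt (by positivity), div_le_iff₀ hl0]
    have h1 : (0 : ℝ) ≤ (P.σ : ℝ) ^ 2 * (2 * (S.γ lam i (t - 1) + 1
        + Real.log (((N : ℝ) + 1) / P.δ))) := by positivity
    have h2 : (P.σ : ℝ) ^ 2 * (infoGain (S.k i) lam fun j : Fin (t - 1) => x (j + 1))
        ≤ (P.σ : ℝ) ^ 2 * S.γ lam i (t - 1) := mul_le_mul_of_nonneg_left hgain (by positivity)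
    -- The only use of `1 ≤ lam` beyond positivity: dividing the quadratic form by `lam` does not
    -- increase it.
    have h3 := le_mul_of_one_le_right h1 hl
    nlinarith [sq_nonneg (P.σ : ℝ)]
  have habs : |S.fn i p - postMean (S.k i) lam (fun j : Fin (t - 1) => x (j + 1))
      (fun j => y i (j + 1)) p|
      ≤ sqrtBeta S P lam i t * postStd (S.k i) lam (fun j : Fin (t - 1) => x (j + 1)) p := by
    rw [hmean, hF, ← sub_sub]
    refine (abs_sub _ _).trans ?_
    rw [sqrtBeta, add_mul]
    refine add_le_add (hbias.trans (by gcongr)) (hnoise.trans ?_)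
    rw [mul_comm]
    gcongr
  have hfn := abs_le.1 (hS.abs_fn_le i hp)
  rw [abs_le] at habs
  exact ⟨max_le (by linarith) hfn.1, le_min (by linarith) hfn.2⟩

end Regular

end Setting

/-- The confidence event has probability at least `1 - δ`. -/
theorem IsRun.measure_compl_confEvent_le {nθ nz N : ℕ} {S : Setting nθ nz N} {P : Params N}
    (hS : S.Regular P) (hδ : P.δ ∈ Set.Ioo (0 : ℝ) 1) {lam : ℝ} (hl : 1 ≤ lam) {T : ℕ}
    {Ω : Type*} [mΩ : MeasurableSpace Ω] {μ : Measure Ω} [IsProbabilityMeasure μ]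
    {ℱ : Filtration ℕ mΩ} {θ : ℕ → Ω → EuclideanSpace ℝ (Fin nθ)}
    {z : ℕ → Ω → EuclideanSpace ℝ (Fin nz)} {ν : Fin (N + 1) → ℕ → Ω → ℝ} {Λ : ℕ → Ω → Fin N → ℝ}
    (h : IsRun S P lam T μ ℱ θ z ν Λ) :
    μ (confEvent S P lam T θ z ν)ᶜ ≤ ENNReal.ofReal P.δ := by
  have hN : (0 : ℝ) < (N : ℝ) + 1 := by positivity
  -- Each function gets failure probability `δ / (N + 1)`, which produces the logarithm in
  -- `sqrtBeta`. The inclusion below is pointwise, so no measurability of the confidence event is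
  -- required.
  let bad : Fin (N + 1) → Set Ω := fun i => {ω | ¬ ∀ n ≤ T,
    selfNormSq (S.k i) lam (fun j : Fin n => pts θ z ω (j + 1)) (fun j => ν i (j + 1) ω)
      ≤ 2 * P.σ ^ 2 * (infoGain (S.k i) lam (fun j : Fin n => pts θ z ω (j + 1))
        + Real.log (1 / (P.δ / ((N : ℝ) + 1))))}
  have hbad : ∀ i, μ (bad i) ≤ ENNReal.ofReal (P.δ / ((N : ℝ) + 1)) := fun i => by
    obtain ⟨H, _, _, φ, hk, -⟩ := (hS.rkhs i).exists_isFeatureMap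
    refine measure_selfNormSq_gt_le hk (hS.measurable_k i) (by linarith)
      (x := fun t ω => pts θ z ω t) (fun t ht => ?_) (h.noise_meas i)
      (h.noise_subG i) (fun t ht => ?_) (div_pos hδ.1 hN)
    · exact (h.primal_meas t ht).prodMk (h.context_meas t ht)
    · refine indep_of_indep_of_le_left (h.noise_indep_past t ht) ?_
      rintro _ ⟨s, hs, rfl⟩
      exact ⟨(fun v : Fin (N + 1) → ℝ => v i) ⁻¹' s, measurable_pi_apply i hs, rfl⟩
  have hsub : (confEvent S P lam T θ z ν)ᶜ ⊆ ⋃ i, bad i := by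
    intro ω hω
    by_contra hcon
    simp only [Set.mem_iUnion, not_exists] at hcon
    refine hω fun t ht p hp i => ?_
    have hgood := not_not.1 (hcon i)
    obtain ⟨ht1, htT⟩ := Finset.mem_Icc.1 ht
    have h1 := hgood (t - 1) (by omega)
    rw [one_div_div] at h1
    refine hS.mem_Icc_lcb_ucb hδ hl i (e := fun j => ν i j ω) (fun _ => rfl) (fun j => ?_) h1 hp
    have hj : (j : ℕ) + 1 ∈ Finset.Icc 1 T := Finset.mem_Icc.2 ⟨by omega, by omega⟩
    exact ⟨(h.path ω).primal_mem _ hj, (h.path ω).context_mem _ hj⟩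
  calc μ (confEvent S P lam T θ z ν)ᶜ ≤ ∑ i, μ (bad i) :=
        (measure_mono hsub).trans (measure_iUnion_fintype_le μ bad)
    _ ≤ ∑ _i : Fin (N + 1), ENNReal.ofReal (P.δ / ((N : ℝ) + 1)) :=
        Finset.sum_le_sum fun i _ => hbad i
    _ = ENNReal.ofReal P.δ := by
        rw [Finset.sum_const, Finset.card_univ, Fintype.card_fin, nsmul_eq_mul,
          ← ENNReal.ofReal_natCast, ← ENNReal.ofReal_mul (by positivity)]
        push_cast
        rw [mul_div_cancel₀ _ hN.ne']

/-! ### Euclidean norms -/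

theorem euclNorm_nonneg {n : ℕ} (v : Fin n → ℝ) : 0 ≤ euclNorm v := Real.sqrt_nonneg _

theorem euclNorm_sq {n : ℕ} (v : Fin n → ℝ) : euclNorm v ^ 2 = ∑ i, v i ^ 2 :=
  Real.sq_sqrt (Finset.sum_nonneg fun _ _ => sq_nonneg _)

theorem le_euclNorm {n : ℕ} (v : Fin n → ℝ) (i : Fin n) : v i ≤ euclNorm v := by
  refine Real.le_sqrt_of_sq_le ?_
  exact Finset.single_le_sum (f := fun i => v i ^ 2) (fun _ _ => sq_nonneg _) (Finset.mem_univ i)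

theorem euclNorm_le_sum {n : ℕ} {v : Fin n → ℝ} (hv : ∀ i, 0 ≤ v i) : euclNorm v ≤ ∑ i, v i :=
  Real.sqrt_le_iff.2 ⟨Finset.sum_nonneg fun i _ => hv i,
    Finset.sum_sq_le_sq_sum_of_nonneg fun i _ => hv i⟩

theorem euclNorm_le_mul {n : ℕ} {v w : Fin n → ℝ} {r : ℝ} (hr : 0 ≤ r) (hv : ∀ i, 0 ≤ v i)
    (h : ∀ i, v i ≤ w i * r) : euclNorm v ≤ euclNorm w * r := by
  refine Real.sqrt_le_iff.2 ⟨mul_nonneg (euclNorm_nonneg w) hr, ?_⟩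
  rw [mul_pow, euclNorm_sq, Finset.sum_mul]
  refine Finset.sum_le_sum fun i _ => ?_
  rw [← mul_pow]
  exact pow_le_pow_left₀ (hv i) (h i) 2

/-! ### Drift of the dual variable -/

/-- Projection to the nonnegative half-line does not increase the square, and the step `l i + ε` has
size at most `2 * C i`. -/
theorem sum_sq_dual_update_le {N : ℕ} {Λ Λ' l C : Fin N → ℝ} {ε : ℝ}
    (hΛ' : ∀ i, Λ' i = max (Λ i + l i + ε) 0) (hl : ∀ i, |l i| ≤ C i) (hε : 0 ≤ ε)
    (hεC : ∀ i, ε ≤ C i) :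
    ∑ i, Λ' i ^ 2 ≤ ∑ i, Λ i ^ 2 + 2 * ∑ i, Λ i * l i + 2 * ε * ∑ i, Λ i + 4 * ∑ i, C i ^ 2 := by
  simp only [Finset.mul_sum, ← Finset.sum_add_distrib]
  refine Finset.sum_le_sum fun i _ => ?_
  have h1 : Λ' i ^ 2 ≤ (Λ i + l i + ε) ^ 2 := by
    rw [hΛ']
    refine sq_le_sq.2 ?_
    rw [abs_of_nonneg (le_max_right _ _)]
    exact max_le (le_abs_self _) (abs_nonneg _)
  obtain ⟨h2, h3⟩ := abs_le.1 (hl i)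
  have h4 : (l i + ε) ^ 2 ≤ (2 * C i) ^ 2 := by
    refine sq_le_sq' ?_ ?_ <;> linarith [hεC i]
  nlinarith

/-- If the coordinate sum is at least `ℓ`, the drift is nonpositive. Otherwise the squared norm is
at most `ℓ ^ 2`, and one step adds at most `D`. -/
theorem sum_sq_dual_le_of_drift {N : ℕ} (hN : 1 ≤ N) {Λ Λ' : Fin N → ℝ} {ξ ℓ D : ℝ} (hξ : 0 < ξ)
    (hℓ : ℓ * ξ = D) (_ : 0 ≤ D) (hΛ : ∀ i, 0 ≤ Λ i)
    (hstep : ∑ i, Λ' i ^ 2 ≤ ∑ i, Λ i ^ 2 + D - ξ * ∑ i, Λ i)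
    (hbound : ∑ i, Λ i ^ 2 ≤ N * ℓ ^ 2 + D) : ∑ i, Λ' i ^ 2 ≤ N * ℓ ^ 2 + D := by
  have hsum : 0 ≤ ∑ i, Λ i := Finset.sum_nonneg fun i _ => hΛ i
  rcases le_total ℓ (∑ i, Λ i) with h | h
  · have := mul_le_mul_of_nonneg_left h hξ.le
    linarith
  · have h1 : ∑ i, Λ i ^ 2 ≤ (∑ i, Λ i) ^ 2 := Finset.sum_sq_le_sq_sum_of_nonneg fun i _ => hΛ i
    have h2 : (∑ i, Λ i) ^ 2 ≤ ℓ ^ 2 := pow_le_pow_left₀ hsum h 2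
    have h3 : (1 : ℝ) ≤ N := by exact_mod_cast hN
    have h4 := mul_le_mul_of_nonneg_right h3 (sq_nonneg ℓ)
    have h5 := mul_nonneg hξ.le hsum
    linarith

/-! ### Deterministic analysis of a sample path on the confidence event -/

section Path

variable {nθ nz N : ℕ} {S : Setting nθ nz N} {P : Params N} {lam : ℝ} {T : ℕ}

theorem eta_pos (hT : 1 ≤ T) : 0 < eta T := by
  have : (0 : ℝ) < T := by exact_mod_cast hT
  unfold eta; positivity

/-- The bound on the squared norm of the dual variable. -/
def dualBound (P : Params N) (T : ℕ) : ℝ :=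
  N * dualInit P T ^ 2 + (4 * P.C 0 / eta T + 4 * euclNorm P.Cg ^ 2)

theorem eps_eq (S : Setting nθ nz N) (P : Params N) (lam : ℝ) (T : ℕ) :
    eps S P lam T = (√(dualBound P T) + 8 * euclNorm (fun i : Fin N => sqrtBeta S P lam i.succ T)
      * √(T * euclNorm (S.γg lam T))) / T := by
  rw [eps, dualBound, add_assoc]

theorem eps_nonneg (S : Setting nθ nz N) (P : Params N) (lam : ℝ) (T : ℕ) :
    0 ≤ eps S P lam T := by
  have := euclNorm_nonneg fun i : Fin N => sqrtBeta S P lam i.succ T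
  unfold eps
  positivity

theorem dualInit_nonneg (hS : S.Regular P) (hξ : 0 < P.ξ) (hT : 1 ≤ T) : 0 ≤ dualInit P T := by
  have := hS.C_nonneg 0
  have := eta_pos hT
  unfold dualInit
  positivity

theorem dualBound_nonneg (hS : S.Regular P) (hT : 1 ≤ T) : 0 ≤ dualBound P T := by
  have := hS.C_nonneg 0
  have := eta_pos hT
  unfold dualBound
  positivity

/-- Along the sampled points, all functions lie between their confidence bounds on the domain. -/
def Confident (S : Setting nθ nz N) (P : Params N) (lam : ℝ) (T : ℕ) (x : ℕ → Pt nθ nz)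
    (y : Fin (N + 1) → ℕ → ℝ) : Prop :=
  ∀ t ∈ Finset.Icc 1 T, ∀ p ∈ S.dom, ∀ i,
    S.fn i p ∈ Set.Icc (lcb S P lam x y i t p) (ucb S P lam x y i t p)

namespace Confident

variable {x : ℕ → Pt nθ nz} {y : Fin (N + 1) → ℕ → ℝ}

theorem abs_lcb_le (hE : Confident S P lam T x y) (hS : S.Regular P) {t : ℕ}
    (ht : t ∈ Finset.Icc 1 T) {p : Pt nθ nz} (hp : p ∈ S.dom) (i : Fin (N + 1)) :
    |lcb S P lam x y i t p| ≤ P.C i :=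
  abs_le.2 ⟨le_max_right _ _, (hE t ht p hp i).1.trans (abs_le.1 (hS.abs_fn_le i hp)).2⟩

theorem fn_sub_lcb_le (hE : Confident S P lam T x y) (hS : S.Regular P) (hl : 0 < lam) {t : ℕ}
    (ht : t ∈ Finset.Icc 1 T) {p : Pt nθ nz} (hp : p ∈ S.dom) (i : Fin (N + 1)) :
    S.fn i p - lcb S P lam x y i t p ≤ 2 * sqrtBeta S P lam i T
      * postStd (S.k i) lam (fun j : Fin (t - 1) => x (j + 1)) p := by
  have h1 := (hE t ht p hp i).2.trans (min_le_left _ _)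
  have h2 : _ ≤ lcb S P lam x y i t p := le_max_left _ _
  have h3 := mul_le_mul_of_nonneg_right (hS.sqrtBeta_mono hl i (Finset.mem_Icc.1 ht).2)
    (postStd_nonneg (S.k i) lam (fun j : Fin (t - 1) => x (j + 1)) p)
  linarith

/-- The cumulative gap between the functions and their lower confidence bounds. -/
theorem sum_fn_le (hE : Confident S P lam T x y) (hS : S.Regular P) (hl : 0 < lam) (hl3 : lam ≤ 3)
    (hx : ∀ t ∈ Finset.Icc 1 T, x t ∈ S.dom) (i : Fin (N + 1)) :
    ∑ t ∈ Finset.Icc 1 T, S.fn i (x t)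
      ≤ ∑ t ∈ Finset.Icc 1 T, lcb S P lam x y i t (x t)
        + 2 * sqrtBeta S P lam i T * √(8 * (T * S.γ lam i T)) := by
  have h1 : ∑ t ∈ Finset.Icc 1 T, (S.fn i (x t) - lcb S P lam x y i t (x t))
      ≤ 2 * sqrtBeta S P lam i T
        * ∑ t ∈ Finset.Icc 1 T, postStd (S.k i) lam (fun j : Fin (t - 1) => x (j + 1)) (x t) := by
    rw [Finset.mul_sum]
    exact Finset.sum_le_sum fun t ht => hE.fn_sub_lcb_le hS hl ht (hx t ht) i
  rw [Finset.sum_sub_distrib] at h1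
  have h2 := mul_le_mul_of_nonneg_left (hS.sum_postStd_le hl hl3 i hx)
    (mul_nonneg zero_le_two (hS.sqrtBeta_nonneg (lam := lam) i T))
  linarith

end Confident

namespace IsPath

variable {θ : ℕ → EuclideanSpace ℝ (Fin nθ)} {z : ℕ → EuclideanSpace ℝ (Fin nz)}
  {y : Fin (N + 1) → ℕ → ℝ} {Λ : ℕ → Fin N → ℝ}

theorem mem_dom (h : IsPath S P lam T θ z y Λ) {t : ℕ} (ht : t ∈ Finset.Icc 1 T) :
    (θ t, z t) ∈ S.dom := ⟨h.primal_mem t ht, h.context_mem t ht⟩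

theorem dual_nonneg (h : IsPath S P lam T θ z y Λ) (hS : S.Regular P) (hξ : 0 < P.ξ)
    (hT : 1 ≤ T) {t : ℕ} (ht : t ∈ Finset.Icc 1 (T + 1)) (i : Fin N) : 0 ≤ Λ t i := by
  obtain ⟨h1, h2⟩ := Finset.mem_Icc.1 ht
  obtain ⟨t, rfl⟩ := Nat.exists_eq_add_of_le' h1
  rcases Nat.eq_zero_or_pos t with rfl | h0
  · rw [h.dual_one]; exact dualInit_nonneg hS hξ hT
  · rw [h.dual_update t (Finset.mem_Icc.2 ⟨h0, by omega⟩)]; exact le_max_right _ _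

/-- The primal minimizer is compared with the Slater point, where the lower bounds of the
constraints are at most `-ξ`. The two objective terms differ by at most `2 * P.C 0`, thanks to the
truncation of the confidence bounds. -/
theorem sum_dual_mul_lcb_le (h : IsPath S P lam T θ z y Λ) (hS : S.Regular P) (hξ : 0 < P.ξ)
    (hT : 1 ≤ T) (hE : Confident S P lam T (fun s => (θ s, z s)) y) {t : ℕ}
    (ht : t ∈ Finset.Icc 1 T) :
    ∑ i, Λ t i * lcb S P lam (fun s => (θ s, z s)) y i.succ t (θ t, z t)
      ≤ 2 * P.C 0 / eta T - P.ξ * ∑ i, Λ t i := by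
  have hη := eta_pos hT
  obtain ⟨θ', hθ', hsl⟩ := hS.slater (z t) (h.context_mem t ht)
  have hmin := h.primal_min t ht hθ'
  simp only [Set.mem_ofPred_eq] at hmin
  have h0 := abs_le.1 (hE.abs_lcb_le hS ht (h.mem_dom ht) 0)
  have h1 := abs_le.1 (hE.abs_lcb_le hS ht (p := (θ', z t)) ⟨hθ', h.context_mem t ht⟩ 0)
  have h2 : ∑ i, Λ t i * lcb S P lam (fun s => (θ s, z s)) y i.succ t (θ', z t)
      ≤ -P.ξ * ∑ i, Λ t i := by
    rw [Finset.mul_sum]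
    refine Finset.sum_le_sum fun i _ => ?_
    rw [mul_comm (-P.ξ)]
    refine mul_le_mul_of_nonneg_left ?_ (h.dual_nonneg hS hξ hT
      (Finset.Icc_subset_Icc_right T.le_succ ht) i)
    exact ((hE t ht (θ', z t) ⟨hθ', h.context_mem t ht⟩ i.succ).1).trans (hsl i)
  have h3 := mul_le_mul_of_nonneg_left h2 hη.le
  rw [le_sub_iff_add_le, le_div_iff₀' hη]
  linarith

theorem sum_sq_dual_succ_le (h : IsPath S P lam T θ z y Λ) (hS : S.Regular P)
    (hξ : 0 < P.ξ) (hε : eps S P lam T ≤ P.ξ / 2)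
    (hE : Confident S P lam T (fun s => (θ s, z s)) y) {t : ℕ} (ht : t ∈ Finset.Icc 1 T) :
    ∑ i, Λ (t + 1) i ^ 2 ≤ ∑ i, Λ t i ^ 2
      + 2 * ∑ i, Λ t i * lcb S P lam (fun s => (θ s, z s)) y i.succ t (θ t, z t)
      + 2 * eps S P lam T * ∑ i, Λ t i + 4 * euclNorm P.Cg ^ 2 := by
  rw [euclNorm_sq]
  exact sum_sq_dual_update_le (h.dual_update t ht)
    (fun i => hE.abs_lcb_le hS ht (h.mem_dom ht) i.succ) (eps_nonneg S P lam T)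
    (fun i => by have := hS.slater_le_C i; simp only [Params.Cg]; linarith)

/-- The Slater comparison contributes `-2ξ` times the sum of the dual coordinates, and `ε ≤ ξ / 2`
gives back at most half of it. The initial value `dualInit` is the level at which the remaining
drift balances the constant term. -/
theorem sum_sq_dual_le (h : IsPath S P lam T θ z y Λ) (hN : 1 ≤ N) (hS : S.Regular P)
    (hξ : 0 < P.ξ) (hT : 1 ≤ T) (hε : eps S P lam T ≤ P.ξ / 2)
    (hE : Confident S P lam T (fun s => (θ s, z s)) y) {t : ℕ}
    (ht : t ∈ Finset.Icc 1 (T + 1)) : ∑ i, Λ t i ^ 2 ≤ dualBound P T := by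
  have hη := eta_pos hT
  have hC := hS.C_nonneg 0
  obtain ⟨h1, h2⟩ := Finset.mem_Icc.1 ht
  induction t, h1 using Nat.le_induction with
  | base =>
    have : 0 ≤ 4 * P.C 0 / eta T + 4 * euclNorm P.Cg ^ 2 := by positivity
    simp [h.dual_one, dualBound, this]
  | succ t h1 ih =>
    have htT : t ∈ Finset.Icc 1 T := Finset.mem_Icc.2 ⟨h1, by omega⟩
    have ht' := Finset.Icc_subset_Icc_right T.le_succ htT
    have hpos := h.dual_nonneg hS hξ hT ht'
    refine sum_sq_dual_le_of_drift hN hξ ?_ (by positivity) hpos ?_ (ih ht' (by omega))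
    · rw [dualInit]; field_simp
    · have h3 := h.sum_sq_dual_succ_le hS hξ hε hE htT
      have h4 := h.sum_dual_mul_lcb_le hS hξ hT hE htT
      have h5 := mul_le_mul_of_nonneg_right hε (Finset.sum_nonneg (s := Finset.univ) fun i _ => hpos i)
      have h6 : 4 * P.C 0 / eta T = 2 * (2 * P.C 0 / eta T) := by ring
      linarith

theorem dual_le (h : IsPath S P lam T θ z y Λ) (hN : 1 ≤ N) (hS : S.Regular P)
    (hξ : 0 < P.ξ) (hT : 1 ≤ T) (hε : eps S P lam T ≤ P.ξ / 2)
    (hE : Confident S P lam T (fun s => (θ s, z s)) y) {t : ℕ}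
    (ht : t ∈ Finset.Icc 1 (T + 1)) (i : Fin N) : Λ t i ≤ √(dualBound P T) :=
  (le_euclNorm (Λ t) i).trans (Real.sqrt_le_sqrt (h.sum_sq_dual_le hN hS hξ hT hε hE ht))

/-- The constraints are satisfied on average. -/
theorem sum_g_nonpos (h : IsPath S P lam T θ z y Λ) (hN : 1 ≤ N) (hS : S.Regular P)
    (hξ : 0 < P.ξ) (hT : 1 ≤ T) (hl : 0 < lam) (hl3 : lam ≤ 3) (hε : eps S P lam T ≤ P.ξ / 2)
    (hE : Confident S P lam T (fun s => (θ s, z s)) y) (i : Fin N) :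
    ∑ t ∈ Finset.Icc 1 T, S.g i (θ t, z t) ≤ 0 := by
  have hT0 : (0 : ℝ) < T := by exact_mod_cast hT
  have h1 := hE.sum_fn_le hS hl hl3 (fun t ht => h.mem_dom ht) i.succ
  -- Dropping the maximum in the dual update bounds each lower confidence bound by a telescoping
  -- difference minus `ε`.
  have h2 : ∑ t ∈ Finset.Icc 1 T, lcb S P lam (fun s => (θ s, z s)) y i.succ t (θ t, z t)
      ≤ ∑ t ∈ Finset.Icc 1 T, (Λ (t + 1) i - Λ t i - eps S P lam T) :=
    Finset.sum_le_sum fun t ht => by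
      rw [h.dual_update t ht i]
      linarith [le_max_left (Λ t i + lcb S P lam (fun s => (θ s, z s)) y i.succ t (θ t, z t)
        + eps S P lam T) 0]
  have h3 : ∑ t ∈ Finset.Icc 1 T, (Λ (t + 1) i - Λ t i - eps S P lam T)
      = Λ (T + 1) i - Λ 1 i - T * eps S P lam T := by
    rw [sum_Icc_one_eq_sum_range, Finset.sum_sub_distrib,
      Finset.sum_range_sub (fun t => Λ (t + 1) i)]
    simp
  have h4 := h.dual_le hN hS hξ hT hε hE (Finset.mem_Icc.2 ⟨by omega, le_rfl⟩ : T + 1 ∈ _) i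
  have h5 := h.dual_nonneg hS hξ hT (Finset.mem_Icc.2 ⟨le_rfl, by omega⟩ : 1 ∈ _) i
  -- The total slack pays for the final dual coordinate, at most `√(dualBound P T)`, and for the
  -- confidence gap. The gap needs only the coefficient `6`, from `2 * √8 ≤ 2 * 3`, out of the
  -- available `8`.
  have h6 : T * eps S P lam T = √(dualBound P T)
      + 8 * euclNorm (fun i : Fin N => sqrtBeta S P lam i.succ T)
        * √(T * euclNorm (S.γg lam T)) := by
    rw [eps_eq]; field_simp
  have h7 := le_euclNorm (fun i : Fin N => sqrtBeta S P lam i.succ T) i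
  have h8 := le_euclNorm (S.γg lam T) i
  have h9 : √(8 * (T * S.γ lam i.succ T)) ≤ 3 * √(T * euclNorm (S.γg lam T)) := by
    have h10 : (3 : ℝ) = √(3 ^ 2) := (Real.sqrt_sq (by norm_num)).symm
    rw [h10, ← Real.sqrt_mul (by norm_num)]
    refine Real.sqrt_le_sqrt ?_
    have h11 : (T : ℝ) * S.γ lam i.succ T ≤ T * euclNorm (S.γg lam T) := by
      gcongr; exact h8
    have h12 := mul_nonneg hT0.le (euclNorm_nonneg (S.γg lam T))
    linarith
  have h13 : 2 * sqrtBeta S P lam i.succ T * √(8 * (T * S.γ lam i.succ T))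
      ≤ 2 * euclNorm (fun i : Fin N => sqrtBeta S P lam i.succ T)
        * (3 * √(T * euclNorm (S.γg lam T))) := by
    have := euclNorm_nonneg fun i : Fin N => sqrtBeta S P lam i.succ T
    gcongr
  have h14 := mul_nonneg (euclNorm_nonneg fun i : Fin N => sqrtBeta S P lam i.succ T)
    (Real.sqrt_nonneg (T * euclNorm (S.γg lam T)))
  have h15 : ∀ t, S.g i (θ t, z t) = S.fn i.succ (θ t, z t) := fun t => rfl
  simp only [h15]
  linarith

theorem violation_eq_zero (h : IsPath S P lam T θ z y Λ) (hN : 1 ≤ N) (hS : S.Regular P)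
    (hξ : 0 < P.ξ) (hT : 1 ≤ T) (hl : 0 < lam) (hl3 : lam ≤ 3) (hε : eps S P lam T ≤ P.ξ / 2)
    (hE : Confident S P lam T (fun s => (θ s, z s)) y) :
    violation S T (fun s => (θ s, z s)) = 0 := by
  have : ∀ i, max (∑ t ∈ Finset.Icc 1 T, S.g i (θ t, z t)) 0 = 0 := fun i =>
    max_eq_right (h.sum_g_nonpos hN hS hξ hT hl hl3 hε hE i)
  simp [violation, this, euclNorm]

/-- The primal minimizer is compared with `θstar`, where feasibility makes the dual-weighted lower
bounds nonpositive. The drift inequality turns the remaining dual term into a telescoping difference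
of squared norms. -/
theorem regret_le (h : IsPath S P lam T θ z y Λ) (hN : 1 ≤ N) (hS : S.Regular P)
    (hξ : 0 < P.ξ) (hT : 1 ≤ T) (hl : 0 < lam) (hl3 : lam ≤ 3) (hε : eps S P lam T ≤ P.ξ / 2)
    (hE : Confident S P lam T (fun s => (θ s, z s)) y)
    {θstar : EuclideanSpace ℝ (Fin nz) → EuclideanSpace ℝ (Fin nθ)}
    (hopt : ∀ z ∈ S.Z, S.IsOptimal z (θstar z)) :
    regret S θstar T (fun s => (θ s, z s))
      ≤ 2 * sqrtBeta S P lam 0 T * √(8 * (T * S.γ lam 0 T))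
        + eta T / 2 * (dualBound P T + T * (2 * eps S P lam T * (N * √(dualBound P T))
          + 4 * euclNorm P.Cg ^ 2)) := by
  have hη := eta_pos hT
  set x : ℕ → Pt nθ nz := fun s => (θ s, z s) with hx
  have hstep : ∀ t ∈ Finset.Icc 1 T, lcb S P lam x y 0 t (x t) - S.f (θstar (z t), z t)
      ≤ eta T / 2 * (∑ i, Λ t i ^ 2 - ∑ i, Λ (t + 1) i ^ 2
        + (2 * eps S P lam T * (N * √(dualBound P T)) + 4 * euclNorm P.Cg ^ 2)) := by
    intro t ht
    have ht' := Finset.Icc_subset_Icc_right T.le_succ ht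
    obtain ⟨hθ', hfeas, -⟩ := hopt (z t) (h.context_mem t ht)
    have hdom : (θstar (z t), z t) ∈ S.dom := ⟨hθ', h.context_mem t ht⟩
    have hmin := h.primal_min t ht hθ'
    simp only [Set.mem_ofPred_eq] at hmin
    have h1 : lcb S P lam x y 0 t (θstar (z t), z t) ≤ S.f (θstar (z t), z t) :=
      (hE t ht _ hdom 0).1
    have h2 : ∑ i, Λ t i * lcb S P lam x y i.succ t (θstar (z t), z t) ≤ 0 :=
      Finset.sum_nonpos fun i _ => mul_nonpos_of_nonneg_of_nonpos
        (h.dual_nonneg hS hξ hT ht' i) (((hE t ht _ hdom i.succ).1).trans (hfeas i))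
    have h3 := mul_le_mul_of_nonneg_left h2 hη.le
    have h4 := h.sum_sq_dual_succ_le hS hξ hε hE ht
    have h5 : ∑ i, Λ t i ≤ N * √(dualBound P T) := by
      refine (Finset.sum_le_sum fun i _ => h.dual_le hN hS hξ hT hε hE ht' i).trans ?_
      simp
    have h6 := mul_le_mul_of_nonneg_left h5 (eps_nonneg S P lam T)
    have h7 : -(2 * ∑ i, Λ t i * lcb S P lam x y i.succ t (θ t, z t))
        ≤ ∑ i, Λ t i ^ 2 - ∑ i, Λ (t + 1) i ^ 2
        + (2 * eps S P lam T * (N * √(dualBound P T)) + 4 * euclNorm P.Cg ^ 2) := by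
      linarith
    have h8 := mul_le_mul_of_nonneg_left h7 (half_pos hη).le
    change lcb S P lam x y 0 t (θ t, z t) - _ ≤ _
    linarith
  have h1 := hE.sum_fn_le hS hl hl3 (fun t ht => h.mem_dom ht) 0
  have h2 := Finset.sum_le_sum hstep
  rw [Finset.sum_sub_distrib, ← Finset.mul_sum, Finset.sum_add_distrib, Finset.sum_const,
    Nat.card_Icc, Nat.add_sub_cancel, nsmul_eq_mul, sum_Icc_one_eq_sum_range
      (fun t => ∑ i, Λ t i ^ 2 - ∑ i, Λ (t + 1) i ^ 2),
    Finset.sum_range_sub' (fun t => ∑ i, Λ (t + 1) i ^ 2), zero_add] at h2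
  have h3 := h.sum_sq_dual_le hN hS hξ hT hε hE (Finset.mem_Icc.2 ⟨le_rfl, by omega⟩ : 1 ∈ _)
  have h4 : 0 ≤ ∑ i, Λ (T + 1) i ^ 2 := Finset.sum_nonneg fun _ _ => sq_nonneg _
  have h5 := mul_le_mul_of_nonneg_left (by linarith : ∑ i, Λ 1 i ^ 2 - ∑ i, Λ (T + 1) i ^ 2
    + T * (2 * eps S P lam T * (N * √(dualBound P T)) + 4 * euclNorm P.Cg ^ 2)
    ≤ dualBound P T + T * (2 * eps S P lam T * (N * √(dualBound P T)) + 4 * euclNorm P.Cg ^ 2))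
    (half_pos hη).le
  have h6 : regret S θstar T x = ∑ t ∈ Finset.Icc 1 T, S.fn 0 (x t)
      - ∑ t ∈ Finset.Icc 1 T, S.f (θstar (z t), z t) := by
    rw [regret, Finset.sum_sub_distrib]; rfl
  rw [h6]
  linarith

end IsPath

end Path

/-! ### Constants -/

section Constants

variable {N : ℕ}

/-- Lower bound of the information gain of the `i`-th constraint. -/
def gainLower (P : Params N) (i : Fin N) : ℝ :=
  1 / 2 * Real.log (1 + (P.ξ / P.C i.succ) ^ 2 / 3)

/-- `√(dualBound P T) ≤ √T * dualConst P`. -/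
def dualConst (P : Params N) : ℝ :=
  √(N * ((4 * P.C 0 + 4 * euclNorm P.Cg ^ 2) / P.ξ) ^ 2 + (4 * P.C 0 + 4 * euclNorm P.Cg ^ 2))

/-- Ratio of the confidence width to the square root of an information gain that is at
least `a`. -/
def betaConst (P : Params N) (a : ℝ) (i : Fin (N + 1)) : ℝ :=
  P.C i / √a + P.σ * √(2 * (1 + (1 + Real.log (((N : ℝ) + 1) / P.δ)) / a))

/-- Ratio of the slackness parameter to `‖γ‖ / √T`. -/
def epsConst (P : Params N) (a : ℝ) : ℝ :=
  dualConst P / a + 8 * euclNorm (fun i : Fin N => betaConst P a i.succ)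

/-- The constant of the regret bound. -/
def regretConst (P : Params N) (a : ℝ) : ℝ :=
  6 * betaConst P a 0 + dualConst P ^ 2 / (2 * a) + epsConst P a * N * dualConst P
    + 2 * euclNorm P.Cg ^ 2 / a

variable {nθ nz : ℕ} {S : Setting nθ nz N} {P : Params N} {lam : ℝ} {T : ℕ} {a : ℝ}

theorem betaConst_nonneg (hS : S.Regular P) (a : ℝ) (i : Fin (N + 1)) :
    0 ≤ betaConst P a i := by
  have := hS.C_nonneg i
  unfold betaConst
  positivity

theorem epsConst_nonneg (ha : 0 < a) : 0 ≤ epsConst P a := by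
  have h1 : 0 ≤ dualConst P := Real.sqrt_nonneg _
  have h2 := euclNorm_nonneg fun i : Fin N => betaConst P a i.succ
  unfold epsConst
  positivity

/-- Since `1 / η = √T`, the initial dual value is of order `√T`; the lower-order terms are absorbed
using `1 ≤ √T ≤ T`. -/
theorem sqrt_dualBound_le (hS : S.Regular P) (hξ : 0 < P.ξ) (hT : 1 ≤ T) :
    √(dualBound P T) ≤ √T * dualConst P := by
  have hT1 : (1 : ℝ) ≤ T := by exact_mod_cast hT
  have hT0 : (0 : ℝ) < T := by linarith
  have hs1 : 1 ≤ √(T : ℝ) := Real.one_le_sqrt.2 hT1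
  have hC := hS.C_nonneg 0
  have hη : ∀ c : ℝ, c / eta T = c * √T := fun c => by rw [eta, div_div_eq_mul_div, div_one]
  have hi : dualInit P T ≤ √T * ((4 * P.C 0 + 4 * euclNorm P.Cg ^ 2) / P.ξ) := by
    rw [dualInit, ← div_div, hη, ← add_div, ← mul_div_assoc]
    gcongr
    nlinarith [sq_nonneg (euclNorm P.Cg)]
  have hi0 := dualInit_nonneg hS hξ hT
  rw [dualConst, ← Real.sqrt_mul hT0.le]
  refine Real.sqrt_le_sqrt ?_
  rw [dualBound, hη, mul_add]
  have h1 : dualInit P T ^ 2 ≤ T * ((4 * P.C 0 + 4 * euclNorm P.Cg ^ 2) / P.ξ) ^ 2 := by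
    have := pow_le_pow_left₀ hi0 hi 2
    rwa [mul_pow, Real.sq_sqrt hT0.le] at this
  have h2 : √(T : ℝ) ≤ T := by
    nlinarith [Real.sq_sqrt hT0.le]
  have h3 := mul_le_mul_of_nonneg_left h2 (mul_nonneg (by norm_num : (0 : ℝ) ≤ 4) hC)
  have h4 := mul_le_mul_of_nonneg_left h1 (Nat.cast_nonneg N : (0 : ℝ) ≤ N)
  have h5 := mul_le_mul_of_nonneg_left hT1 (sq_nonneg (euclNorm P.Cg))
  linarith

/-- The additive constants are absorbed through `1 ≤ G / a`, so the width is of order `√G`. -/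
theorem sqrtBeta_le (hS : S.Regular P) (hδ : P.δ ∈ Set.Ioo (0 : ℝ) 1) (hl : 0 < lam)
    (ha : 0 < a) (i : Fin (N + 1)) {G : ℝ} (haG : a ≤ G) (hG : S.γ lam i T ≤ G) :
    sqrtBeta S P lam i T ≤ betaConst P a i * √G := by
  have hG0 : 0 < G := ha.trans_le haG
  have hC := hS.C_nonneg i
  have hL : 0 ≤ Real.log (((N : ℝ) + 1) / P.δ) := by
    refine Real.log_nonneg ((one_le_div₀ hδ.1).2 ?_)
    have : (0 : ℝ) ≤ N := Nat.cast_nonneg N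
    linarith [hδ.2]
  rw [sqrtBeta, betaConst, add_mul, mul_assoc, ← Real.sqrt_mul (by positivity)]
  refine add_le_add ?_ ?_
  · rw [div_mul_eq_mul_div, le_div_iff₀ (by positivity)]
    gcongr
  · refine mul_le_mul_of_nonneg_left (Real.sqrt_le_sqrt ?_) P.σ.2
    have h1 := (hS.γ_mono hl i (Nat.sub_le T 1)).trans hG
    have h2 : 1 + Real.log (((N : ℝ) + 1) / P.δ)
        ≤ (1 + Real.log (((N : ℝ) + 1) / P.δ)) / a * G := by
      rw [div_mul_eq_mul_div, le_div_iff₀ ha]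
      gcongr
    linarith

/-- After division by `T`, the dual term is of order `1 / √T`, absorbed by `a ≤ Γ`. In the
confidence term one `√Γ` comes from the widths and the other from the square root already present.
-/
theorem eps_le (hS : S.Regular P) (hδ : P.δ ∈ Set.Ioo (0 : ℝ) 1) (hξ : 0 < P.ξ) (hT : 1 ≤ T)
    (hl : 0 < lam) (ha : 0 < a) (haΓ : a ≤ euclNorm (S.γg lam T)) :
    eps S P lam T ≤ epsConst P a * (euclNorm (S.γg lam T) / √T) := by
  have hT0 : (0 : ℝ) < T := by exact_mod_cast hT
  set Γ := euclNorm (S.γg lam T) with hΓ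
  have hΓ0 : 0 < Γ := ha.trans_le haΓ
  have h1 := sqrt_dualBound_le hS hξ hT
  have h2 : euclNorm (fun i : Fin N => sqrtBeta S P lam i.succ T)
      ≤ euclNorm (fun i : Fin N => betaConst P a i.succ) * √Γ :=
    euclNorm_le_mul (Real.sqrt_nonneg _) (fun i => hS.sqrtBeta_nonneg _ _) fun i =>
      sqrtBeta_le hS hδ hl ha i.succ haΓ (le_euclNorm (S.γg lam T) i)
  have h3 : dualConst P ≤ dualConst P / a * Γ := by
    rw [div_mul_eq_mul_div, le_div_iff₀ ha]
    exact mul_le_mul_of_nonneg_left haΓ (Real.sqrt_nonneg _)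
  rw [eps_eq, div_le_iff₀ hT0, Real.sqrt_mul hT0.le]
  have h4 : epsConst P a * (Γ / √T) * T = epsConst P a * Γ * √T := by
    rw [mul_div_assoc', div_mul_eq_mul_div, mul_div_assoc, Real.div_sqrt]
  have h5 := mul_le_mul_of_nonneg_left h3 (Real.sqrt_nonneg (T : ℝ))
  have h6 := mul_le_mul_of_nonneg_right h2
    (mul_nonneg (Real.sqrt_nonneg (T : ℝ)) (Real.sqrt_nonneg Γ))
  have h7 : √Γ * √Γ = Γ := Real.mul_self_sqrt hΓ0.le
  rw [h4, epsConst]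
  have h8 : euclNorm (fun i : Fin N => betaConst P a i.succ) * √Γ * (√T * √Γ)
      = euclNorm (fun i : Fin N => betaConst P a i.succ) * Γ * √T := by
    linear_combination euclNorm (fun i : Fin N => betaConst P a i.succ) * √T * h7
  rw [h8] at h6
  nlinarith

/-- With `r = √T`, the confidence term and the slackness term are of order `G * r`. The squared dual
norm and the step sizes contribute order `r`, which `a ≤ G` absorbs. -/
theorem regret_bound_le (hS : S.Regular P) (hδ : P.δ ∈ Set.Ioo (0 : ℝ) 1) (hξ : 0 < P.ξ)
    (hT : 1 ≤ T) (hl : 0 < lam) (ha : 0 < a) (haΓ : a ≤ euclNorm (S.γg lam T)) :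
    2 * sqrtBeta S P lam 0 T * √(8 * (T * S.γ lam 0 T))
        + eta T / 2 * (dualBound P T + T * (2 * eps S P lam T * (N * √(dualBound P T))
          + 4 * euclNorm P.Cg ^ 2))
      ≤ regretConst P a * ((∑ i, S.γ lam i T) * √T) := by
  have hT0 : (0 : ℝ) < T := by exact_mod_cast hT
  set G := ∑ i, S.γ lam i T with hG
  have hγ := fun i => hS.γ_nonneg hl i T
  have hΓG : euclNorm (S.γg lam T) ≤ G := by
    rw [hG, Fin.sum_univ_succ]
    have := euclNorm_le_sum (v := S.γg lam T) fun i => hγ i.succ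
    have h0 := hγ 0
    simp only [Setting.γg] at this ⊢
    linarith
  have haG := haΓ.trans hΓG
  have hG0 : 0 < G := ha.trans_le haG
  have hγ0 : S.γ lam 0 T ≤ G :=
    Finset.single_le_sum (f := fun i => S.γ lam i T) (fun i _ => hγ i) (Finset.mem_univ 0)
  obtain ⟨r, hr0, hr2⟩ : ∃ r : ℝ, 0 < r ∧ (T : ℝ) = r ^ 2 :=
    ⟨√T, Real.sqrt_pos.2 hT0, (Real.sq_sqrt hT0.le).symm⟩
  have hr : √(T : ℝ) = r := by rw [hr2, Real.sqrt_sq hr0.le]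
  have hA0 : 0 ≤ dualConst P := Real.sqrt_nonneg _
  have hM0 : 0 ≤ √(dualBound P T) := Real.sqrt_nonneg _
  have hM : √(dualBound P T) ≤ r * dualConst P := hr ▸ sqrt_dualBound_le hS hξ hT
  have hM2 : dualBound P T ≤ r ^ 2 * dualConst P ^ 2 := by
    rw [← mul_pow, ← Real.sq_sqrt (dualBound_nonneg hS hT)]
    exact pow_le_pow_left₀ hM0 hM 2
  have hε : eps S P lam T ≤ epsConst P a * (G / r) := by
    refine (eps_le hS hδ hξ hT hl ha haΓ).trans ?_
    rw [hr]
    have := epsConst_nonneg (P := P) ha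
    gcongr
  have hb : sqrtBeta S P lam 0 T ≤ betaConst P a 0 * √G := sqrtBeta_le hS hδ hl ha 0 haG hγ0
  have hb0 := betaConst_nonneg hS a 0
  have hs : √(8 * (T * S.γ lam 0 T)) ≤ 3 * r * √G := by
    have h9 : 3 * r = √((3 * r) ^ 2) := (Real.sqrt_sq (by positivity)).symm
    rw [h9, ← Real.sqrt_mul (by positivity), hr2]
    refine Real.sqrt_le_sqrt ?_
    have := mul_le_mul_of_nonneg_left hγ0 (sq_nonneg r)
    nlinarith [mul_nonneg (sq_nonneg r) hG0.le]
  have h1 : 2 * sqrtBeta S P lam 0 T * √(8 * (T * S.γ lam 0 T))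
      ≤ 6 * betaConst P a 0 * (G * r) := by
    calc 2 * sqrtBeta S P lam 0 T * √(8 * (T * S.γ lam 0 T))
        ≤ 2 * (betaConst P a 0 * √G) * (3 * r * √G) := by
          have := hS.sqrtBeta_nonneg (lam := lam) 0 T
          gcongr
      _ = 6 * betaConst P a 0 * ((√G * √G) * r) := by ring
      _ = 6 * betaConst P a 0 * (G * r) := by rw [Real.mul_self_sqrt hG0.le]
  have h2 : eps S P lam T * (N * √(dualBound P T))
      ≤ epsConst P a * (G / r) * (N * (r * dualConst P)) := by
    have := epsConst_nonneg (P := P) ha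
    gcongr
  have h3 : eta T / 2 * (dualBound P T + T * (2 * eps S P lam T * (N * √(dualBound P T))
          + 4 * euclNorm P.Cg ^ 2))
      ≤ 1 / r / 2 * (r ^ 2 * dualConst P ^ 2
        + r ^ 2 * (2 * (epsConst P a * (G / r) * (N * (r * dualConst P)))
          + 4 * euclNorm P.Cg ^ 2)) := by
    rw [eta, hr, hr2, mul_assoc 2 (eps S P lam T)]
    gcongr
  have h4 : 1 / r / 2 * (r ^ 2 * dualConst P ^ 2
        + r ^ 2 * (2 * (epsConst P a * (G / r) * (N * (r * dualConst P)))
          + 4 * euclNorm P.Cg ^ 2))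
      = (dualConst P ^ 2 / 2 + 2 * euclNorm P.Cg ^ 2) * r
        + epsConst P a * N * dualConst P * (G * r) := by
    field_simp
    ring
  have h5 : (dualConst P ^ 2 / 2 + 2 * euclNorm P.Cg ^ 2) * r
      ≤ (dualConst P ^ 2 / (2 * a) + 2 * euclNorm P.Cg ^ 2 / a) * (G * r) := by
    have h6 : (dualConst P ^ 2 / (2 * a) + 2 * euclNorm P.Cg ^ 2 / a) * (G * r)
        = (dualConst P ^ 2 / 2 + 2 * euclNorm P.Cg ^ 2) * r * (G / a) := by
      field_simp
    rw [h6]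
    exact le_mul_of_one_le_right (by positivity) ((one_le_div₀ ha).2 haG)
  rw [hr, regretConst]
  linarith

end Constants

end PDCBO

end

/-! ### Assembly of the main theorem -/

theorem theorem1 {N : ℕ} (hN : 1 ≤ N) (P : PDCBO.Params N)
    (hδ : P.δ ∈ Set.Ioo (0 : ℝ) 1) (hξ : 0 < P.ξ) :
    -- the constant depends only on `N`, `C`, `σ`, `δ`, `ξ`
    ∃ c : ℝ, ∀ {nθ nz : ℕ} (S : PDCBO.Setting nθ nz N) (_ : S.Regular P)
      (θstar : EuclideanSpace ℝ (Fin nz) → EuclideanSpace ℝ (Fin nθ))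
      (_ : ∀ z ∈ S.Z, S.IsOptimal z (θstar z))
      -- the noise variance of the Gaussian process model, chosen for each horizon `T`
      (lam : ℕ → ℝ) (_ : ∀ T : ℕ, 1 ≤ T → 0 < lam T ∧ lam T ≤ 1 + 2 / (T : ℝ))
      (_ : Tendsto (fun T : ℕ => PDCBO.euclNorm (S.γg (lam T) T) / √(T : ℝ)) atTop (𝓝 0)),
      -- the size of the slackness parameter
      (∀ T : ℕ, 1 ≤ T →
        PDCBO.eps S P (lam T) T ≤ c * (PDCBO.euclNorm (S.γg (lam T) T) / √(T : ℝ))) ∧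
      (∀ᶠ T : ℕ in atTop, PDCBO.eps S P (lam T) T ≤ P.ξ / 2) ∧
      -- the guarantees
      ∀ T : ℕ, 1 ≤ T → PDCBO.eps S P (lam T) T ≤ P.ξ / 2 →
        ∀ {Ω : Type*} [mΩ : MeasurableSpace Ω] (μ : Measure Ω) [IsProbabilityMeasure μ]
          (ℱ : Filtration ℕ mΩ) (θ : ℕ → Ω → EuclideanSpace ℝ (Fin nθ))
          (z : ℕ → Ω → EuclideanSpace ℝ (Fin nz)) (ν : Fin (N + 1) → ℕ → Ω → ℝ)
          (Λ : ℕ → Ω → Fin N → ℝ) (_ : PDCBO.IsRun S P (lam T) T μ ℱ θ z ν Λ),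
          (1 ≤ lam T →
            μ (PDCBO.confEvent S P (lam T) T θ z ν)ᶜ ≤ ENNReal.ofReal P.δ) ∧
          ∀ ω ∈ PDCBO.confEvent S P (lam T) T θ z ν,
            PDCBO.regret S θstar T (PDCBO.pts θ z ω)
              ≤ c * ((∑ i, S.γ (lam T) i T) * √(T : ℝ)) ∧
            PDCBO.violation S T (PDCBO.pts θ z ω) = 0 := by
  -- One constraint suffices to bound the norm of the gain vector below. This bound depends on the
  -- parameters alone, so `c` can be chosen before the setting; its positivity is proved once a
  -- regular setting is given.
  set a := PDCBO.gainLower P ⟨0, hN⟩ with ha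
  refine ⟨max (PDCBO.epsConst P a) (PDCBO.regretConst P a), ?_⟩
  intro nθ nz S hS θstar hopt lam hlam hγ
  have hC : 0 < P.C (Fin.succ ⟨0, hN⟩) := hξ.trans_le (hS.slater_le_C ⟨0, hN⟩)
  have ha0 : 0 < a := by
    have : 0 < (P.ξ / P.C (Fin.succ ⟨0, hN⟩)) ^ 2 / 3 := by positivity
    exact mul_pos one_half_pos (Real.log_pos (by linarith))
  have hl3 : ∀ T : ℕ, 1 ≤ T → lam T ≤ 3 := fun T hT => by
    have hT1 : (1 : ℝ) ≤ T := by exact_mod_cast hT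
    have : 2 / (T : ℝ) ≤ 2 := div_le_self zero_le_two hT1
    linarith [(hlam T hT).2]
  have haΓ : ∀ T : ℕ, 1 ≤ T → a ≤ PDCBO.euclNorm (S.γg (lam T) T) := fun T hT =>
    (hS.le_γ_succ hξ (hlam T hT).1 (hl3 T hT) ⟨0, hN⟩ hT).trans
      (PDCBO.le_euclNorm (S.γg (lam T) T) ⟨0, hN⟩)
  have heps : ∀ T : ℕ, 1 ≤ T → PDCBO.eps S P (lam T) T
      ≤ max (PDCBO.epsConst P a) (PDCBO.regretConst P a)
        * (PDCBO.euclNorm (S.γg (lam T) T) / √(T : ℝ)) := fun T hT =>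
    (PDCBO.eps_le hS hδ hξ hT (hlam T hT).1 ha0 (haΓ T hT)).trans <|
      mul_le_mul_of_nonneg_right (le_max_left _ _)
        (div_nonneg (PDCBO.euclNorm_nonneg _) (Real.sqrt_nonneg _))
  refine ⟨heps, ?_, ?_⟩
  · have hlim := hγ.const_mul (max (PDCBO.epsConst P a) (PDCBO.regretConst P a))
    rw [mul_zero] at hlim
    filter_upwards [hlim.eventually_lt_const (half_pos hξ), eventually_ge_atTop 1] with T h1 hT
    exact (heps T hT).trans h1.le
  · intro T hT hε Ω mΩ μ _ ℱ θ z ν Λ hrun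
    refine ⟨fun hl => hrun.measure_compl_confEvent_le hS hδ hl, fun ω hω => ?_⟩
    have hl := (hlam T hT).1
    have hE : PDCBO.Confident S P (lam T) T (fun s => (θ s ω, z s ω)) (PDCBO.obs S θ z ν ω) := hω
    refine ⟨?_, (hrun.path ω).violation_eq_zero hN hS hξ hT hl (hl3 T hT) hε hE⟩
    refine ((hrun.path ω).regret_le hN hS hξ hT hl (hl3 T hT) hε hE hopt).trans ?_
    refine (PDCBO.regret_bound_le hS hδ hξ hT hl ha0 (haΓ T hT)).trans ?_
    refine mul_le_mul_of_nonneg_right (le_max_right _ _) (mul_nonneg ?_ (Real.sqrt_nonneg _))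
    exact Finset.sum_nonneg fun i _ => hS.γ_nonneg hl i T
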